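/- Let $$M=\begin{bmatrix} 0&1&0&0\\ -1&0&0&1\\ 0&0&-1&1\\ 0&0&0&1\end{bmatrix}\in GL_4(\mathbb Z),\qquad M^4=I,$$ let $G=\mathbb Z_4=\langle x\mid x^4=1\rangle$ act on $L=\mathbb Z^4$, regarded as row vectors, by $x\cdot l=lM$ (so $x$ sends the $i$-th basis vector to the $i$-th row of $M$), and let $\Gamma=L\rtimes G$. For each $j\ge 0$ let $G$ act on $H^j(L,\mathbb Z)$ by the action induced from that on $L$; the coefficients $\mathbb Z$ are trivial throughout. Then $$H^4(\Gamma,\mathbb Z)\cong \mathbb Z_4\oplus\mathbb Z_4,\qquad \bigoplus_{i+j=4}H^i\bigl(G,H^j(L,\mathbb Z)\bigr)\cong \mathbb Z_4\oplus\mathbb Z_2\oplus\mathbb Z_2\oplus\mathbb Z_2,$$ and these two groups are not isomorphic. Consequently the Adem–Ge–Pan–Petrosyan conjecture is false: it is not true that for every finite cyclic group $G$, every $\mathbb Z G$-lattice $L$ (a $\mathbb Z G$-module that is finitely generated and free as an abelian group) and every $k\ge 0$ one has $$H^k(L\rtimes G,\mathbb Z)\cong\bigoplus_{i+j=k}H^i\bigl(G,H^j(L,\mathbb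 Z)\bigr).$$ -/

import Mathlib

open CategoryTheory DirectSum

noncomputable section

namespace SplitLattice

variable {G L : Type} [Group G] [AddCommGroup L]

/-- The action of `G` on the multiplicatively written lattice `L` by group automorphisms that is
given by a `ℤ`-linear representation of `G` on `L`. -/
def latticeAut (ρ : Representation ℤ G L) : G →* MulAut (Multiplicative L) where
  toFun g :=
    { toFun := fun l => Multiplicative.ofAdd (ρ g l.toAdd)
      invFun := fun l => Multiplicative.ofAdd (ρ g⁻¹ l.toAdd)
      left_inv := fun l => by simp
      right_inv := fun l => by simp
      map_mul' := fun a b => by simp }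
  map_one' := by ext l; simp
  map_mul' g h := by ext l; simp

/-- The split extension `L ⋊ G`. -/
abbrev Gam (ρ : Representation ℤ G L) : Type :=
  Multiplicative L ⋊[latticeAut ρ] G

/-- The map `f^* : H^j(K, ℤ) → H^j(K, ℤ)` (pullback of cocycles along `f`) induced by an
endomorphism `f` of the group `K`, with trivial coefficients `ℤ`. -/
def pullback {K : Type} [Group K] (f : K →* K) (j : ℕ) :
    groupCohomology (Rep.trivial ℤ K ℤ) j ⟶ groupCohomology (Rep.trivial ℤ K ℤ) j :=
  groupCohomology.map (A := Rep.trivial ℤ K ℤ) (B := Rep.trivial ℤ K ℤ) f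
    (Rep.ofHom ⟨LinearMap.id, fun _ => rfl⟩) j

theorem pullback_id {K : Type} [Group K] (j : ℕ) :
    pullback (MonoidHom.id K) j = 𝟙 _ :=
  groupCohomology.map_id (B := Rep.trivial ℤ K ℤ) j

theorem pullback_comp {K : Type} [Group K] (f g : K →* K) (j : ℕ) :
    pullback (f.comp g) j = pullback f j ≫ pullback g j :=
  groupCohomology.map_comp (A := Rep.trivial ℤ K ℤ) (B := Rep.trivial ℤ K ℤ)
    (C := Rep.trivial ℤ K ℤ) f g (Rep.ofHom ⟨LinearMap.id, fun _ => rfl⟩)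
    (Rep.ofHom ⟨LinearMap.id, fun _ => rfl⟩) j

/-- `H^j(L, ℤ)` as a `ℤ[G]`-module: `g` acts by pullback along the automorphism `g⁻¹` of `L`. -/
def cohomologyRep (ρ : Representation ℤ G L) (j : ℕ) : Rep ℤ G :=
  Rep.of (X := groupCohomology (Rep.trivial ℤ (Multiplicative L) ℤ) j)
    { toFun := fun g => (pullback (latticeAut ρ g⁻¹).toMonoidHom j).hom
      map_one' := by
        have h : (latticeAut ρ (1 : G)⁻¹).toMonoidHom = MonoidHom.id (Multiplicative L) := by
          rw [inv_one, map_one]; rfl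
        rw [h, pullback_id]; rfl
      map_mul' := fun g g' => by
        have h : (latticeAut ρ (g * g')⁻¹).toMonoidHom =
            (latticeAut ρ g'⁻¹).toMonoidHom.comp (latticeAut ρ g⁻¹).toMonoidHom := by
          rw [mul_inv_rev, map_mul]; rfl
        rw [h, pullback_comp]; rfl }

/-- `⨁_{i+j=k} H^i(G, H^j(L, ℤ))`. -/
abbrev E2Sum (ρ : Representation ℤ G L) (k : ℕ) : Type :=
  ⨁ p : Finset.HasAntidiagonal.antidiagonal k, groupCohomology (cohomologyRep ρ p.1.2) p.1.1

/-- `H^k(L ⋊ G, ℤ)` with trivial coefficients. -/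
abbrev HGam (ρ : Representation ℤ G L) (k : ℕ) : Type :=
  groupCohomology (Rep.trivial ℤ (Gam ρ) ℤ) k

end SplitLattice

open SplitLattice in
/-- The Adem–Ge–Pan–Petrosyan conjecture: for every finite cyclic group `G`, every `ℤ[G]`-lattice
`L` (finitely generated and free over `ℤ`) and every `k`, the group `H^k(L ⋊ G, ℤ)` is isomorphic
to `⨁_{i+j=k} H^i(G, H^j(L, ℤ))`. -/
def AdemGePanPetrosyanConjecture : Prop :=
  ∀ (G : Type) [Group G] [Finite G] [IsCyclic G]
    (L : Type) [AddCommGroup L] [Module.Finite ℤ L] [Module.Free ℤ L]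
    (ρ : Representation ℤ G L) (k : ℕ), Nonempty (HGam ρ k ≃+ E2Sum ρ k)

/-- The matrix `M`. -/
def matM : Matrix (Fin 4) (Fin 4) ℤ :=
  !![ 0, 1,  0, 0;
     -1, 0,  0, 1;
      0, 0, -1, 1;
      0, 0,  0, 1]

theorem matM_pow_four : matM ^ 4 = 1 := by decide

/-- The cyclic group `ℤ_4 = ⟨x⟩`, written multiplicatively, acting on `ℤ^4`: the generator
`x` sends the row vector `l` to `l M`, hence the `i`-th basis vector to the `i`-th row of `M`. -/
def rhoM : Representation ℤ (Multiplicative (ZMod 4)) (Fin 4 → ℤ) where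
  toFun g := (matM ^ g.toAdd.val).vecMulLinear
  map_one' := by
    refine LinearMap.ext fun v => ?_
    simp
  map_mul' g h := by
    have hp : matM ^ (g * h).toAdd.val = matM ^ h.toAdd.val * matM ^ g.toAdd.val := by
      rw [toAdd_mul, ZMod.val_add, ← pow_add, ← pow_eq_pow_mod _ matM_pow_four, add_comm]
    refine LinearMap.ext fun v => ?_
    rw [hp]
    simp [Matrix.vecMul_vecMul]

end

open CategoryTheory DirectSum

noncomputable section

namespace SplitLattice

/-! ### Classes of inhomogeneous cocycles and vanishing for coinduced modules -/

section Basics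

variable {k G : Type} [CommRing k] [Group G]

/-! The two groups have different orders, 16 and 32. The 32 is a direct calculation. `coordMap`
identifies H^j(ℤ^n, ℤ), for j > 0, with the free group on the j-element sets of coordinates, the
action being given by the j × j minors of the matrix. Cohomology of a cyclic group in positive
degree is then ker P / im Q for two integer matrices, settled by an explicit certificate.

For the 16, the Lyndon–Hochschild–Serre bound over L = ℤ^4 is too weak, since it allows order 32.
Instead, the form l₀ + l₁ + l₂ + 2 l₃ is invariant, so Γ is a split extension of ℤ by Γ₃ = L₃ ⋊ ℤ_4,
where L₃ is the kernel of the form. All terms H^i(ℤ_4, H^j(L₃)) with i + j = 3 vanish, hence H^3(Γ₃)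
= 0, and restriction H^4(Γ) → H^4(Γ₃) is injective (`resMap_kernelSplit_injective`). The same bound
gives |H^4(Γ₃)| ≤ 64 (`card_H4_rho3`). Evaluating on four cyclic subgroups of order four,
combinations of cup products of explicit 2-classes take 64 distinct values, so these subgroups
detect H^4(Γ₃) (`detect3_injective`). In Γ their generators fall into only two conjugacy classes, so
H^4(Γ) embeds in ℤ_4 ⊕ ℤ_4 (`detectM_injective`), and two explicit cup squares generate this target
(`detectM_surjective`).

No spectral sequence is constructed. Only its numerical consequence is needed, and it is proved by
dimension shifting for any size that is subadditive along exact sequences (`SplitExt.le_ker_resMap`,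
`SplitExt.le_groupCohomology`). Taking the order as size bounds H^4(Γ₃); taking the number of
generators bounds the cohomology of ℤ^n. -/

theorem contractNth_zero_cons {n : ℕ} (h : G) (g : Fin (n + 1) → G) :
    Fin.contractNth 0 (· * ·) (Fin.cons h g : Fin (n + 2) → G) =
      Fin.cons (h * g 0) (fun i => g i.succ) := by
  funext i
  refine Fin.cases ?_ (fun i => ?_) i
  · simp [Fin.contractNth]
  · simp [Fin.contractNth]

theorem contractNth_succ_cons {n : ℕ} (h : G) (g : Fin (n + 1) → G) (j : Fin (n + 1)) :
    Fin.contractNth j.succ (· * ·) (Fin.cons h g : Fin (n + 2) → G) =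
      Fin.cons h (Fin.contractNth j (· * ·) g) := by
  funext i
  refine Fin.cases ?_ (fun i => ?_) i
  · simp [Fin.contractNth]
  · simp only [Fin.contractNth, Fin.cons_succ, Fin.val_succ, add_lt_add_iff_right,
      add_left_inj]
    split_ifs <;> simp [Fin.castSucc_succ]

theorem π_surjective (A : Rep k G) (n : ℕ) : Function.Surjective (groupCohomology.π A n) :=
  (ModuleCat.epi_iff_surjective _).1
    (inferInstanceAs (Epi ((groupCohomology.inhomogeneousCochains A).homologyπ n)))

/-- The cohomology class of a cocycle. -/
def cls {A : Rep k G} {n : ℕ} (f : (Fin n → G) → A) (hf : inhomogeneousCochains.d A n f = 0) :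
    groupCohomology A n :=
  groupCohomology.π A n (groupCohomology.cocyclesMk f hf)

theorem exists_cls {A : Rep k G} {n : ℕ} (x : groupCohomology A n) :
    ∃ f hf, x = cls (A := A) (n := n) f hf := by
  obtain ⟨z, rfl⟩ := π_surjective A n x
  have hz : inhomogeneousCochains.d A n (groupCohomology.iCocycles A n z) = 0 := by
    have := congr($((groupCohomology.inhomogeneousCochains A).iCycles_d n (n + 1)) z)
    rw [groupCohomology.inhomogeneousCochains.d_def] at this
    exact this
  refine ⟨_, hz, congrArg _ ?_⟩
  apply (ModuleCat.mono_iff_injective (groupCohomology.iCocycles A n)).1 inferInstance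
  exact (groupCohomology.iCocycles_mk _ hz).symm

theorem cls_eq_zero_of_d {A : Rep k G} {n : ℕ} (f : (Fin (n + 1) → G) → A) (hf)
    (s : (Fin n → G) → A) (hs : inhomogeneousCochains.d A n s = f) :
    cls (A := A) f hf = 0 := by
  have h1 : groupCohomology.cocyclesMk f hf = groupCohomology.toCocycles A n (n + 1) s := by
    apply (ModuleCat.mono_iff_injective (groupCohomology.iCocycles A (n + 1))).1 inferInstance
    refine (groupCohomology.iCocycles_mk _ hf).trans ?_
    have := congr($((groupCohomology.inhomogeneousCochains A).toCycles_i n (n + 1)) s)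
    rw [groupCohomology.inhomogeneousCochains.d_def] at this
    exact (this.trans hs).symm
  rw [cls, h1]
  exact congr($((groupCohomology.inhomogeneousCochains A).toCycles_comp_homologyπ n (n + 1)) s)

theorem map_cls {H : Type} [Group H] {A : Rep k H} {B : Rep k G} (f : G →* H)
    (φ : Rep.res f A ⟶ B) {n : ℕ} (c : (Fin n → H) → A) (hc) (hc') :
    groupCohomology.map f φ n (cls (A := A) c hc) =
      cls (A := B) (fun g => φ.hom (c (f ∘ g))) hc' := by
  rw [cls, cls]
  have := congr($(groupCohomology.π_map f φ n) (groupCohomology.cocyclesMk c hc))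
  refine this.trans ?_
  refine congrArg (groupCohomology.π B n) ?_
  apply (ModuleCat.mono_iff_injective (groupCohomology.iCocycles B n)).1 inferInstance
  refine Eq.trans ?_ (groupCohomology.iCocycles_mk _ hc').symm
  have h2 := congr($(HomologicalComplex.cyclesMap_i (groupCohomology.cochainsMap f φ) n)
    (groupCohomology.cocyclesMk c hc))
  refine h2.trans ?_
  change (groupCohomology.cochainsMap f φ).f n (groupCohomology.iCocycles A n _) = _
  rw [groupCohomology.iCocycles_mk]
  rfl

theorem map_cocycle {H : Type} [Group H] {A : Rep.{0} k H} {B : Rep.{0} k G} (f : G →* H)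
    (φ : Rep.res f A ⟶ B) {n : ℕ} (c : (Fin n → H) → A)
    (hc : inhomogeneousCochains.d A n c = 0) :
    inhomogeneousCochains.d B n (fun g => φ.hom (c (f ∘ g))) = 0 := by
  have h := (groupCohomology.cochainsMap (A := A) (B := B) f φ).comm n (n + 1)
  have := congr(ConcreteCategory.hom $h c)
  rw [groupCohomology.inhomogeneousCochains.d_def,
    groupCohomology.inhomogeneousCochains.d_def] at this
  refine this.trans ?_
  change (groupCohomology.cochainsMap f φ).f (n + 1) (inhomogeneousCochains.d A n c) = 0
  rw [hc]
  exact map_zero _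

/-- The hypothesis identifies `A` with Fun(G, W). Stating it through a functional `e`, rather than
for a fixed model, lets it serve for coinduced modules, for their restriction to a normal subgroup,
and for the invariants of that subgroup. -/
theorem subsingleton_of_coinduced (A : Rep k G) {W : Type} [AddCommGroup W] [Module k W]
    (e : A.V →ₗ[k] W) (he : Function.Bijective fun (a : A) (g : G) => e (A.ρ g a)) (n : ℕ) :
    Subsingleton (groupCohomology A (n + 1)) := by
  refine subsingleton_of_forall_eq 0 fun x => ?_
  obtain ⟨f, hf, rfl⟩ := exists_cls x
  -- The contracting homotopy: the coordinate of `s g` at `h` is that of f(h, g). The cocycle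
  -- identity of `f` at (h, g) then says precisely that d s = f.
  choose s hs using fun g : Fin n → G => he.2 (fun h => e (f (Fin.cons h g)))
  have hs' : ∀ g h, e (A.ρ h (s g)) = e (f (Fin.cons h g)) := fun g h => congrFun (hs g) h
  refine cls_eq_zero_of_d f hf s ?_
  funext g
  apply he.1
  funext h
  have h0 : e (inhomogeneousCochains.d A (n + 1) f (Fin.cons h g)) = 0 := by
    rw [hf]; exact map_zero e
  have hρ : ∀ a b (v : A), A.ρ a (A.ρ b v) = A.ρ (a * b) v := fun a b v => by
    rw [map_mul]; rfl
  rw [inhomogeneousCochains.d_hom_apply, Fin.sum_univ_succ, contractNth_zero_cons] at h0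
  simp only [contractNth_succ_cons, Fin.cons_zero, Fin.cons_succ, map_add, map_sum, map_smul,
    Fin.val_zero, Fin.val_succ] at h0
  rw [inhomogeneousCochains.d_hom_apply]
  simp only [map_add, map_sum, map_smul, hs', hρ]
  rw [← sub_eq_zero, ← neg_eq_zero, ← h0]
  simp only [pow_succ, pow_zero, mul_neg, mul_one, neg_neg, neg_smul, one_smul,
    Finset.sum_neg_distrib]
  abel

/-- A linear functional on cochains that vanishes on coboundaries induces a map on cohomology. -/
def descend {A : Rep k G} {M : Type} [AddCommGroup M] [Module k M] {n : ℕ}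
    (F : ((Fin (n + 1) → G) → A) →ₗ[k] M) (hF : ∀ c, F (inhomogeneousCochains.d A n c) = 0) :
    groupCohomology A (n + 1) →ₗ[k] M :=
  ((groupCohomology.inhomogeneousCochains A).homologyι (n + 1) ≫
    (groupCohomology.inhomogeneousCochains A).descOpcycles (i := n + 1) (A := ModuleCat.of k M)
      (ModuleCat.ofHom F) n (by simp) (by
        rw [groupCohomology.inhomogeneousCochains.d_def]
        ext c
        exact hF c)).hom

theorem descend_cls {A : Rep k G} {M : Type} [AddCommGroup M] [Module k M] {n : ℕ}
    (F : ((Fin (n + 1) → G) → A) →ₗ[k] M) (hF) (f : (Fin (n + 1) → G) → A) (hf) :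
    descend F hF (cls f hf) = F f := by
  have h := (groupCohomology.inhomogeneousCochains A).homology_π_ι (n + 1)
  have h1 := congr(ConcreteCategory.hom $h (groupCohomology.cocyclesMk f hf))
  have h2 := (groupCohomology.inhomogeneousCochains A).p_descOpcycles (i := n + 1)
    (A := ModuleCat.of k M) (ModuleCat.ofHom F) n (by simp) (by
        rw [groupCohomology.inhomogeneousCochains.d_def]
        ext c
        exact hF c)
  have h3 := congr(ConcreteCategory.hom $h2
    (groupCohomology.iCocycles A (n + 1) (groupCohomology.cocyclesMk f hf)))
  refine Eq.trans ?_ (h3.trans ?_)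
  · exact congrArg (ModuleCat.Hom.hom ((groupCohomology.inhomogeneousCochains A).descOpcycles
      (i := n + 1) (A := ModuleCat.of k M) (ModuleCat.ofHom F) n (by simp) _)) h1
  · rw [groupCohomology.iCocycles_mk]
    rfl

end Basics

/-! ### Long exact sequences and dimension shifting -/

section LongExact

variable {k G H : Type} [CommRing k] [Group G] [Group H] {X : ShortComplex (Rep k G)}

theorem exact_δ_map (hX : X.ShortExact) (n : ℕ) :
    Function.Exact (groupCohomology.δ hX n (n + 1) rfl)
      (groupCohomology.map (.id G) X.f (n + 1)) :=
  (ShortComplex.ShortExact.moduleCat_exact_iff_function_exact _).1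
    (groupCohomology.mapShortComplex₁_exact hX rfl)

theorem exact_map_map (hX : X.ShortExact) (n : ℕ) :
    Function.Exact (groupCohomology.map (.id G) X.f n) (groupCohomology.map (.id G) X.g n) :=
  (ShortComplex.ShortExact.moduleCat_exact_iff_function_exact _).1
    (groupCohomology.mapShortComplex₂_exact hX n)

theorem exact_map_δ (hX : X.ShortExact) (n : ℕ) :
    Function.Exact (groupCohomology.map (.id G) X.g n)
      (groupCohomology.δ hX n (n + 1) rfl) :=
  (ShortComplex.ShortExact.moduleCat_exact_iff_function_exact _).1
    (groupCohomology.mapShortComplex₃_exact hX rfl)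

/-- Naturality of the connecting homomorphism with respect to a change of groups. -/
theorem δ_map_naturality {Y : ShortComplex (Rep k H)} (hX : X.ShortExact) (hY : Y.ShortExact)
    (f : H →* G) (φ : X.map (Rep.resFunctor f) ⟶ Y) (n : ℕ) :
    groupCohomology.δ hX n (n + 1) rfl ≫ groupCohomology.map f φ.τ₁ (n + 1) =
      groupCohomology.map f φ.τ₃ n ≫ groupCohomology.δ hY n (n + 1) rfl :=
  HomologicalComplex.HomologySequence.δ_naturality
    (S₁ := X.map (groupCohomology.cochainsFunctor k G))
    (S₂ := Y.map (groupCohomology.cochainsFunctor k H))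
    { τ₁ := groupCohomology.cochainsMap f φ.τ₁
      τ₂ := groupCohomology.cochainsMap f φ.τ₂
      τ₃ := groupCohomology.cochainsMap f φ.τ₃
      comm₁₂ := congrArg (groupCohomology.cochainsMap f) φ.comm₁₂
      comm₂₃ := congrArg (groupCohomology.cochainsMap f) φ.comm₂₃ }
    (groupCohomology.map_cochainsFunctor_shortExact hX)
    (groupCohomology.map_cochainsFunctor_shortExact hY) n (n + 1) rfl

end LongExact

section DimensionShift

variable {k G : Type} [CommRing k] [Group G]

/-- All functions `G → A` with `G` acting by right translation of the argument. -/
def coinduced (A : Rep k G) : Rep k G :=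
  Rep.of (X := G → A)
    { toFun g := LinearMap.funLeft k A (· * g)
      map_one' := by ext; simp [LinearMap.funLeft]
      map_mul' a b := by ext; simp [LinearMap.funLeft, mul_assoc] }

theorem coinduced_ρ_apply (A : Rep k G) (g : G) (f : G → A) (s : G) :
    ((coinduced A).ρ g f : G → A) s = f (s * g) := rfl

/-- The orbit map `a ↦ (s ↦ s • a)`. -/
def toCoinduced (A : Rep k G) : A ⟶ coinduced A :=
  Rep.ofHom (σ := (coinduced A).ρ) ⟨LinearMap.pi fun s => A.ρ s, fun g => by
    ext a
    funext s
    change A.ρ s (A.ρ g a) = A.ρ (s * g) a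
    rw [map_mul]; rfl⟩

theorem toCoinduced_apply (A : Rep k G) (a : A) (s : G) :
    ((toCoinduced A).hom a : G → A) s = A.ρ s a := rfl

theorem toCoinduced_range_le (A : Rep k G) (g : G) :
    LinearMap.range (toCoinduced A).hom.toLinearMap ≤
      (LinearMap.range (toCoinduced A).hom.toLinearMap).comap ((coinduced A).ρ g) := by
  rintro _ ⟨a, rfl⟩
  exact ⟨A.ρ g a, Rep.hom_comm_apply (toCoinduced A) g a⟩

/-- The short exact sequence `0 → A → Fun(G, A) → A' → 0`. -/
def shiftComplex (A : Rep k G) : ShortComplex (Rep k G) where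
  X₁ := A
  X₂ := coinduced A
  X₃ := Rep.quotient (coinduced A) _ (toCoinduced_range_le A)
  f := toCoinduced A
  g := Rep.mkQ (coinduced A) _ (toCoinduced_range_le A)
  zero := by
    ext a
    exact (Submodule.Quotient.mk_eq_zero _).2 ⟨a, rfl⟩

theorem shiftComplex_shortExact (A : Rep k G) : (shiftComplex A).ShortExact where
  exact := by
    rw [← ShortComplex.exact_map_iff_of_faithful _ (forget₂ (Rep k G) (ModuleCat k)),
      ShortComplex.ShortExact.moduleCat_exact_iff_function_exact]
    exact LinearMap.exact_map_mkQ_range (toCoinduced A).hom.toLinearMap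
  mono_f := (Rep.mono_iff_injective _).2 fun a b h => by
    have h1 : A.ρ 1 a = A.ρ 1 b := congrFun h (1 : G)
    rw [map_one] at h1
    exact h1
  epi_g := (Rep.epi_iff_surjective _).2 (Submodule.mkQ_surjective _)

end DimensionShift

/-! ### Conjugation acting on cohomology -/

section Conjugation

variable {k N Γ : Type} [CommRing k] [Group N] [Group Γ]

/-- If `f : N → N` is conjugation by `c⁻¹ ∈ Γ` seen through `i : N → Γ`, the action of `c` on a
representation of `Γ` is a morphism over `f`. -/
def conjHom (i : N →* Γ) (c : Γ) (f : N →* N) (h : ∀ n, i (f n) = c⁻¹ * i n * c) (A : Rep.{0} k Γ) :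
    Rep.res f (Rep.res i A) ⟶ Rep.res i A :=
  Rep.ofHom (ρ := (Rep.res f (Rep.res i A)).ρ) (σ := (Rep.res i A).ρ) ⟨A.ρ c, fun n => by
    change A.ρ c ∘ₗ A.ρ (i (f n)) = A.ρ (i n) ∘ₗ A.ρ c
    rw [← Module.End.mul_eq_comp, ← Module.End.mul_eq_comp, ← map_mul, ← map_mul, h]
    group⟩

/-- The action of `c ∈ Γ` on the cohomology of `N`. -/
def conjMap (i : N →* Γ) (c : Γ) (f : N →* N) (h : ∀ n, i (f n) = c⁻¹ * i n * c) (A : Rep.{0} k Γ)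
    (n : ℕ) : groupCohomology (Rep.res i A) n ⟶ groupCohomology (Rep.res i A) n :=
  groupCohomology.map f (conjHom i c f h A) n

theorem conjMap_one (i : N →* Γ) (h) (A : Rep k Γ) (n : ℕ) :
    conjMap i 1 (MonoidHom.id N) h A n = 𝟙 _ := by
  rw [← groupCohomology.map_id]
  exact groupCohomology.map_congr rfl (by ext x; exact congr($(map_one A.ρ) x)) n

theorem conjMap_mul (i : N →* Γ) (c c' : Γ) (f f' : N →* N) (h h' h'') (A : Rep k Γ) (n : ℕ) :
    conjMap i (c * c') (f'.comp f) h'' A n = conjMap i c' f' h' A n ≫ conjMap i c f h A n := by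
  rw [conjMap, conjMap, conjMap, ← groupCohomology.map_comp]
  exact groupCohomology.map_congr rfl (by ext x; exact congr($(map_mul A.ρ c c') x)) n

theorem conjMap_naturality (i : N →* Γ) (c : Γ) (f : N →* N) (h) {A B : Rep k Γ} (φ : A ⟶ B)
    (n : ℕ) :
    conjMap i c f h A n ≫ groupCohomology.map (.id N) ((Rep.resFunctor i).map φ) n =
      groupCohomology.map (.id N) ((Rep.resFunctor i).map φ) n ≫ conjMap i c f h B n := by
  rw [conjMap, conjMap, ← groupCohomology.map_comp, ← groupCohomology.map_comp]
  exact groupCohomology.map_congr rfl (by ext x; exact Rep.hom_comm_apply φ c x) n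

theorem conjMap_δ (i : N →* Γ) (c : Γ) (f : N →* N) (h) {X : ShortComplex (Rep k Γ)}
    (hX : (X.map (Rep.resFunctor i)).ShortExact) (n : ℕ) :
    conjMap i c f h X.X₃ n ≫ groupCohomology.δ hX n (n + 1) rfl =
      groupCohomology.δ hX n (n + 1) rfl ≫ conjMap i c f h X.X₁ (n + 1) :=
  (δ_map_naturality hX hX f
    { τ₁ := conjHom i c f h X.X₁
      τ₂ := conjHom i c f h X.X₂
      τ₃ := conjHom i c f h X.X₃
      comm₁₂ := by
        ext x
        exact Rep.hom_comm_apply X.f c x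
      comm₂₃ := by
        ext x
        exact Rep.hom_comm_apply X.g c x } n).symm

theorem subsingleton_coinduced (A : Rep k Γ) (n : ℕ) :
    Subsingleton (groupCohomology (coinduced A) (n + 1)) :=
  subsingleton_of_coinduced (coinduced A) (LinearMap.proj (1 : Γ))
    (by
      have : (fun (a : coinduced A) (g : Γ) => (LinearMap.proj (1 : Γ) : (Γ → A) →ₗ[k] A)
          ((coinduced A).ρ g a)) = fun a => (a : Γ → A) := by
        funext a g
        exact (coinduced_ρ_apply A g a 1).trans (by rw [one_mul])
      exact this ▸ Function.bijective_id) n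

theorem shift_δ_surjective (A : Rep k Γ) (n : ℕ) :
    Function.Surjective (groupCohomology.δ (shiftComplex_shortExact A) n (n + 1) rfl) := fun x => by
  refine (exact_δ_map (shiftComplex_shortExact A) n x).1 ?_
  have := subsingleton_coinduced A n
  exact @Subsingleton.elim (groupCohomology (coinduced A) (n + 1)) _ _ _

/-- Inner automorphisms act trivially on group cohomology. -/
theorem conjMap_self (n : ℕ) (c : Γ) (f : Γ →* Γ) (h : ∀ g, MonoidHom.id Γ (f g) = c⁻¹ * g * c)
    (A : Rep k Γ) (x : groupCohomology A n) :
    conjMap (MonoidHom.id Γ) c f h A n x = x := by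
  induction n generalizing A with
  | zero =>
    obtain ⟨z, hz, rfl⟩ := exists_cls x
    rw [conjMap]
    refine (map_cls (B := A) f _ z hz (map_cocycle _ _ z hz)).trans ?_
    congr 1
    funext g
    -- A 0-cocycle is an invariant vector; its cocycle condition at `c` is the claim.
    have h0 := congrFun hz (fun _ => c)
    rw [inhomogeneousCochains.d_hom_apply] at h0
    have h1 : A.ρ c (z g) + (-1 : k) ^ (0 + 1) • z g = 0 := by
      refine Eq.trans ?_ h0
      rw [Fin.sum_univ_succ, Fin.sum_univ_zero, add_zero]
      congr!
    rw [Subsingleton.elim (f ∘ g) g]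
    rw [zero_add, pow_one, neg_smul, one_smul, ← sub_eq_add_neg] at h1
    exact sub_eq_zero.1 h1
  | succ n ih =>
    -- Every class of positive degree is a connecting image, and conjugation commutes with the
    -- connecting map, so the claim descends to degree `n`.
    obtain ⟨y, rfl⟩ := shift_δ_surjective A n x
    have h1 := conjMap_δ (MonoidHom.id Γ) c f h (X := shiftComplex A)
      (shiftComplex_shortExact A) n
    have h2 := congr(ConcreteCategory.hom $h1 y)
    refine h2.symm.trans ?_
    exact congrArg
      (ConcreteCategory.hom (groupCohomology.δ (shiftComplex_shortExact A) n (n + 1) rfl)) (ih _ y)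

end Conjugation

section Invariants

variable {k G H : Type} [CommRing k] [Group G] [Group H]

/-- Zeroth cohomology as invariants. -/
def ev0 (A : Rep.{0} k G) : groupCohomology A 0 →ₗ[k] A.V :=
  A.ρ.invariants.subtype ∘ₗ (groupCohomology.H0Iso A).hom.hom

theorem ev0_injective (A : Rep.{0} k G) : Function.Injective (ev0 A) :=
  Subtype.val_injective.comp
    ((ModuleCat.mono_iff_injective (groupCohomology.H0Iso A).hom).1 inferInstance)

theorem exists_ev0 (A : Rep.{0} k G) (a : A) (ha : ∀ g, A.ρ g a = a) : ∃ x, ev0 A x = a := by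
  obtain ⟨x, hx⟩ := (ModuleCat.epi_iff_surjective (groupCohomology.H0Iso A).hom).1 inferInstance
    ⟨a, ha⟩
  exact ⟨x, congrArg Subtype.val hx⟩

theorem ρ_ev0 (A : Rep.{0} k G) (x : groupCohomology A 0) (g : G) : A.ρ g (ev0 A x) = ev0 A x :=
  ((groupCohomology.H0Iso A).hom.hom x).2 g

theorem ev0_map {A : Rep.{0} k H} {B : Rep.{0} k G} (f : G →* H) (φ : Rep.res f A ⟶ B)
    (x : groupCohomology A 0) : ev0 B (groupCohomology.map f φ 0 x) = φ.hom (ev0 A x) := by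
  have h := groupCohomology.map_H0Iso_hom_f (A := A) (B := B) f φ
  exact congr(ConcreteCategory.hom $h x)

end Invariants

/-- A group extension `1 → N → Γ → G → 1` with a section. -/
structure SplitExt (N Γ G : Type) [Group N] [Group Γ] [Group G] where
  i : N →* Γ
  s : G →* Γ
  p : Γ →* G
  i_injective : Function.Injective i
  p_s : ∀ g, p (s g) = g
  p_i : ∀ n, p (i n) = 1
  exists_i : ∀ x, p x = 1 → ∃ n, i n = x

/-! ### The cohomology of the normal subgroup as a module over the quotient -/

namespace SplitExt

variable {k N Γ G : Type} [CommRing k] [Group N] [Group Γ] [Group G] (E : SplitExt N Γ G)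

theorem exists_conj (c : Γ) (n : N) : ∃ m, E.i m = c⁻¹ * E.i n * c :=
  E.exists_i _ (by simp [E.p_i])

/-- Conjugation by `c⁻¹` on `N`. -/
def conj (c : Γ) : N →* N where
  toFun n := (E.exists_conj c n).choose
  map_one' := E.i_injective (by rw [(E.exists_conj c 1).choose_spec]; simp)
  map_mul' a b := E.i_injective (by
    refine (E.exists_conj c (a * b)).choose_spec.trans ?_
    rw [map_mul, map_mul, (E.exists_conj c a).choose_spec, (E.exists_conj c b).choose_spec]
    group)

theorem i_conj (c : Γ) (n : N) : E.i (E.conj c n) = c⁻¹ * E.i n * c :=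
  (E.exists_conj c n).choose_spec

theorem conj_one : E.conj 1 = MonoidHom.id N :=
  MonoidHom.ext fun n => E.i_injective (by simp [i_conj])

theorem conj_mul (c d : Γ) : E.conj (c * d) = (E.conj d).comp (E.conj c) :=
  MonoidHom.ext fun n => E.i_injective (by simp [i_conj, mul_assoc])

theorem exists_eq_mul (x : Γ) : ∃ n, x = E.s (E.p x) * E.i n := by
  obtain ⟨n, hn⟩ := E.exists_i ((E.s (E.p x))⁻¹ * x) (by simp [E.p_s])
  exact ⟨n, by rw [hn]; group⟩

theorem mul_injective {g g' : G} {n n' : N} (h : E.s g * E.i n = E.s g' * E.i n') :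
    g = g' ∧ n = n' := by
  have hg : g = g' := by
    have := congrArg E.p h
    simpa [E.p_s, E.p_i] using this
  subst hg
  exact ⟨rfl, E.i_injective (mul_left_cancel h)⟩

/-- `H^j(N, A)` as a representation of the quotient group `G`. -/
def hs (A : Rep.{0} k Γ) (j : ℕ) : Rep.{0} k G :=
  Rep.of (X := groupCohomology (Rep.res E.i A) j)
    { toFun g := (conjMap E.i (E.s g) (E.conj (E.s g)) (E.i_conj _) A j).hom
      map_one' := by
        have h : ∀ (c : Γ) (f : N →* N) (hf) (_ : c = 1) (_ : f = MonoidHom.id N),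
            conjMap E.i c f hf A j = 𝟙 _ := by
          rintro _ _ hf rfl rfl
          exact conjMap_one E.i hf A j
        rw [h _ _ _ (map_one E.s) (by rw [map_one, conj_one])]
        rfl
      map_mul' g g' := by
        have h : ∀ (c : Γ) (f : N →* N) (hf) (_ : c = E.s g * E.s g')
            (_ : f = (E.conj (E.s g')).comp (E.conj (E.s g))),
            conjMap E.i c f hf A j = conjMap E.i (E.s g') (E.conj (E.s g')) (E.i_conj _) A j ≫
              conjMap E.i (E.s g) (E.conj (E.s g)) (E.i_conj _) A j := by
          rintro _ _ hf rfl rfl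
          exact conjMap_mul E.i _ _ _ _ _ _ hf A j
        rw [h _ _ _ (map_mul E.s g g') (by rw [map_mul, conj_mul])]
        rfl }

theorem ev0_hs (A : Rep.{0} k Γ) (g : G) (x : groupCohomology (Rep.res E.i A) 0) :
    ev0 (Rep.res E.i A) ((E.hs A 0).ρ g x : groupCohomology (Rep.res E.i A) 0) =
      A.ρ (E.s g) (ev0 (Rep.res E.i A) x) :=
  ev0_map _ (conjHom E.i (E.s g) (E.conj (E.s g)) (E.i_conj _) A) x

/-- Functoriality of `hs` in the coefficients. -/
def hsMap {A B : Rep.{0} k Γ} (φ : A ⟶ B) (j : ℕ) : E.hs A j ⟶ E.hs B j :=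
  Rep.ofHom (ρ := (E.hs A j).ρ) (σ := (E.hs B j).ρ)
    ⟨(groupCohomology.map (.id N) ((Rep.resFunctor E.i).map φ) j).hom, fun g =>
      congrArg ModuleCat.Hom.hom (conjMap_naturality E.i (E.s g) (E.conj (E.s g)) (E.i_conj _) φ j)⟩

theorem res_shortExact {X : ShortComplex (Rep.{0} k Γ)} (hX : X.ShortExact) :
    (X.map (Rep.resFunctor E.i)).ShortExact :=
  (Rep.shortExact_res E.i).2 hX

/-- The connecting homomorphism is equivariant. -/
def hsδ {X : ShortComplex (Rep.{0} k Γ)} (hX : X.ShortExact) (j : ℕ) :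
    E.hs X.X₃ j ⟶ E.hs X.X₁ (j + 1) :=
  Rep.ofHom (ρ := (E.hs X.X₃ j).ρ) (σ := (E.hs X.X₁ (j + 1)).ρ)
    ⟨(groupCohomology.δ (E.res_shortExact hX) j (j + 1) rfl).hom, fun g =>
      congrArg ModuleCat.Hom.hom (conjMap_δ E.i (E.s g) (E.conj (E.s g)) (E.i_conj _)
        (E.res_shortExact hX) j)⟩

/-- Restriction to the normal subgroup. -/
def resMap (A : Rep.{0} k Γ) (n : ℕ) : groupCohomology A n →ₗ[k] groupCohomology (Rep.res E.i A) n :=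
  (groupCohomology.map E.i (𝟙 (Rep.res E.i A)) n).hom

theorem resMap_δ {X : ShortComplex (Rep.{0} k Γ)} (hX : X.ShortExact) (n : ℕ)
    (x : groupCohomology X.X₃ n) :
    E.resMap X.X₁ (n + 1) (groupCohomology.δ hX n (n + 1) rfl x) =
      groupCohomology.δ (E.res_shortExact hX) n (n + 1) rfl (E.resMap X.X₃ n x) := by
  have h := δ_map_naturality hX (E.res_shortExact hX) E.i (𝟙 (X.map (Rep.resFunctor E.i))) n
  exact congr(ConcreteCategory.hom $h x)

/-- Restriction intertwines conjugation by `s g` on N with conjugation by `s g` on Γ, and the latter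
is inner, hence trivial on cohomology. -/
theorem hs_ρ_resMap (A : Rep.{0} k Γ) (n : ℕ) (x : groupCohomology A n) (g : G) :
    ((E.hs A n).ρ g (E.resMap A n x) : groupCohomology (Rep.res E.i A) n) = E.resMap A n x := by
  let f : Γ →* Γ := (MulAut.conj (E.s g)⁻¹).toMonoidHom
  have hf : ∀ γ, MonoidHom.id Γ (f γ) = (E.s g)⁻¹ * γ * E.s g := fun γ => by simp [f]
  have h1 : groupCohomology.map E.i (𝟙 (Rep.res E.i A)) n ≫
      conjMap E.i (E.s g) (E.conj (E.s g)) (E.i_conj _) A n =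
      conjMap (MonoidHom.id Γ) (E.s g) f hf A n ≫
        groupCohomology.map E.i (𝟙 (Rep.res E.i A)) n := by
    rw [conjMap, conjMap, ← groupCohomology.map_comp]
    refine Eq.trans ?_ (groupCohomology.map_comp (A := A) (B := A) (C := Rep.res E.i A) f E.i
      (conjHom (MonoidHom.id Γ) (E.s g) f hf A) (𝟙 (Rep.res E.i A)) n)
    have hfi : E.i.comp (E.conj (E.s g)) = f.comp E.i := by
      ext m
      simp [f, i_conj]
    exact groupCohomology.map_congr hfi (by ext; rfl) n
  refine (congr(ConcreteCategory.hom $h1 x)).trans ?_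
  exact congrArg (E.resMap A n) (conjMap_self n (E.s g) f hf A x)

end SplitExt

/-- A notion of size for abelian groups that is subadditive along exact sequences. -/
structure SizeBound where
  le : ℕ → (M : Type) → [AddCommGroup M] → Prop
  le_of_exact : ∀ {A B C : Type} [AddCommGroup A] [AddCommGroup B] [AddCommGroup C] {a b : ℕ}
    (f : A →+ B) (g : B →+ C), Function.Exact f g → le a A → le b C → le (a + b) B
  le_zero : ∀ (A : Type) [AddCommGroup A], Subsingleton A → le 0 A

/-! ### Subadditive sizes -/

namespace SizeBound

variable (S : SizeBound) {A B : Type} [AddCommGroup A] [AddCommGroup B] {a : ℕ}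

theorem le_of_injective (f : A →+ B) (hf : Function.Injective f) (h : S.le a B) : S.le a A := by
  have := S.le_of_exact (0 : PUnit.{1} →+ A) f
    (fun x => ⟨fun hx => ⟨0, (hf (hx.trans (map_zero f).symm)).symm⟩, by rintro ⟨_, rfl⟩; exact map_zero f⟩)
    (S.le_zero _ inferInstance) h
  rwa [zero_add] at this

theorem le_of_surjective (f : A →+ B) (hf : Function.Surjective f) (h : S.le a A) : S.le a B :=
  S.le_of_exact f (0 : B →+ PUnit.{1}) (fun x => ⟨fun _ => hf x, fun _ => rfl⟩) h
    (S.le_zero _ inferInstance)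

theorem le_of_le_range (f : A →+ B) (P : AddSubgroup B) (hf : P ≤ f.range) (h : S.le a A) :
    S.le a P := by
  let g : P.comap f →+ P := (f.comp (P.comap f).subtype).codRestrict P fun x => x.2
  refine S.le_of_surjective g ?_ (S.le_of_injective (P.comap f).subtype Subtype.val_injective h)
  rintro ⟨_, hy⟩
  obtain ⟨x, rfl⟩ := hf hy
  exact ⟨⟨x, hy⟩, rfl⟩

end SizeBound

section Rep

variable {k G : Type} [CommRing k] [Group G]

theorem shortExact_of {R₁ R₂ R₃ : Rep.{0} k G} (f : R₁ ⟶ R₂) (g : R₂ ⟶ R₃)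
    (hf : Function.Injective f.hom) (hfg : Function.Exact f.hom g.hom)
    (hg : Function.Surjective g.hom) :
    (ShortComplex.mk f g (by ext x; exact hfg.apply_apply_eq_zero x)).ShortExact where
  exact := by
    rw [← ShortComplex.exact_map_iff_of_faithful _ (forget₂ (Rep k G) (ModuleCat k)),
      ShortComplex.ShortExact.moduleCat_exact_iff_function_exact]
    exact hfg
  mono_f := (Rep.mono_iff_injective _).2 hf
  epi_g := (Rep.epi_iff_surjective _).2 hg

theorem map_bijective {R₁ R₂ : Rep.{0} k G} (f : R₁ ⟶ R₂) (hf : Function.Bijective f.hom) (n : ℕ) :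
    Function.Bijective (groupCohomology.map (.id G) f n) := by
  have : Mono f := (Rep.mono_iff_injective _).2 hf.1
  have : Epi f := (Rep.epi_iff_surjective _).2 hf.2
  have : IsIso f := isIso_of_mono_of_epi f
  have h : IsIso ((groupCohomology.functor k G n).map f) := inferInstance
  exact (ConcreteCategory.isIso_iff_bijective ((groupCohomology.functor k G n).map f)).1 h

theorem exists_factor_ker {R₂ R₃ R₄ : Rep.{0} k G} (g : R₂ ⟶ R₃) (d : R₃ ⟶ R₄)
    (hgd : Function.Exact g.hom d.hom) :
    ∃ (K : Rep.{0} k G) (ι : K ⟶ R₃) (q : R₂ ⟶ K), Function.Injective ι.hom ∧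
      Function.Exact ι.hom d.hom ∧ Function.Surjective q.hom ∧ ∀ x, ι.hom (q.hom x) = g.hom x := by
  have hK : ∀ g, LinearMap.ker d.hom.toLinearMap ≤
      (LinearMap.ker d.hom.toLinearMap).comap (R₃.ρ g) := fun γ x hx => by
    have h1 : d.hom x = 0 := hx
    change d.hom (R₃.ρ γ x) = 0
    rw [Rep.hom_comm_apply, h1, map_zero]
  refine ⟨Rep.subrepresentation R₃ _ hK, Rep.subtype R₃ _ hK,
    Rep.ofHom (ρ := R₂.ρ) (σ := (Rep.subrepresentation R₃ _ hK).ρ)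
      ⟨g.hom.toLinearMap.codRestrict _ fun x => hgd.apply_apply_eq_zero x, fun γ => ?_⟩,
    Subtype.val_injective, fun x => ⟨fun h => ⟨⟨x, h⟩, rfl⟩, ?_⟩, fun x => ?_, fun x => rfl⟩
  · ext x
    exact Rep.hom_comm_apply g γ x
  · rintro ⟨y, rfl⟩
    exact y.2
  · obtain ⟨y, hy⟩ := (hgd x.1).1 x.2
    exact ⟨y, Subtype.ext hy⟩

/-- The four-term sequence is cut at K = ker d. Vanishing of H^n(R₂) embeds H^n(K) in H^{n+1}(R₁),
and H^n(R₃) lies between H^n(K) and H^n(R₄). -/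
theorem SizeBound.le_of_exact₄ (S : SizeBound) {R₁ R₂ R₃ R₄ : Rep.{0} k G} (f : R₁ ⟶ R₂)
    (g : R₂ ⟶ R₃) (d : R₃ ⟶ R₄) (hf : Function.Injective f.hom)
    (hfg : Function.Exact f.hom g.hom) (hgd : Function.Exact g.hom d.hom)
    (hd : Function.Surjective d.hom) (n : ℕ) (h₂ : Subsingleton (groupCohomology R₂ n)) {a b : ℕ}
    (h₁ : S.le a (groupCohomology R₁ (n + 1))) (h₄ : S.le b (groupCohomology R₄ n)) :
    S.le (a + b) (groupCohomology R₃ n) := by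
  obtain ⟨K, ι, q, hι, hιd, hq, hιq⟩ := exists_factor_ker g d hgd
  have hfq : Function.Exact f.hom q.hom := fun x => by
    rw [← hfg x, ← hιq, map_eq_zero_iff _ hι]
  have s₁ := shortExact_of f q hf hfq hq
  have s₂ := shortExact_of ι d hι hιd hd
  have hK : S.le a (groupCohomology K n) := by
    refine S.le_of_injective (groupCohomology.δ s₁ n (n + 1) rfl).hom.toAddMonoidHom ?_ h₁
    refine (injective_iff_map_eq_zero _).2 fun x hx => ?_
    obtain ⟨y, rfl⟩ := (exact_map_δ s₁ n x).1 hx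
    rw [@Subsingleton.elim _ h₂ y 0]
    exact map_zero _
  exact S.le_of_exact (groupCohomology.map (.id G) ι n).hom.toAddMonoidHom
    (groupCohomology.map (.id G) d n).hom.toAddMonoidHom (exact_map_map s₂ n) hK h₄

end Rep

/-! ### Coinduced modules over the normal subgroup and over the quotient -/

namespace SplitExt

variable {k N Γ G : Type} [CommRing k] [Group N] [Group Γ] [Group G] (E : SplitExt N Γ G)

/-- Each element of Γ is uniquely s(g) i(n), so over N the module Fun(Γ, A) is Fun(N, Fun(G, A)). -/
theorem subsingleton_res_coinduced (A : Rep.{0} k Γ) (n : ℕ) :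
    Subsingleton (groupCohomology (Rep.res E.i (coinduced A)) (n + 1)) := by
  refine subsingleton_of_coinduced (Rep.res E.i (coinduced A)) (W := G → A)
    (LinearMap.funLeft k A E.s) ⟨fun f f' h => ?_, fun F => ?_⟩ n
  · funext x
    obtain ⟨m, hm⟩ := E.exists_eq_mul x
    rw [hm]
    exact congrFun (congrFun h m) (E.p x)
  · refine ⟨fun x => F (E.exists_eq_mul x).choose (E.p x), ?_⟩
    funext m g
    have h := (E.exists_eq_mul (E.s g * E.i m)).choose_spec
    have hp : E.p (E.s g * E.i m) = g := by simp [E.p_s, E.p_i]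
    change F (E.exists_eq_mul (E.s g * E.i m)).choose (E.p (E.s g * E.i m)) = F m g
    rw [← (E.mul_injective h).2, hp]

/-- The N-invariants of Fun(Γ, A) are the functions constant on cosets of N, that is Fun(G, A),
which is coinduced over G. -/
theorem subsingleton_hs_coinduced (A : Rep.{0} k Γ) (n : ℕ) :
    Subsingleton (groupCohomology (E.hs (coinduced A) 0) (n + 1)) := by
  have key : ∀ (x : groupCohomology (Rep.res E.i (coinduced A)) 0) (g : G),
      (ev0 (Rep.res E.i (coinduced A))
        ((E.hs (coinduced A) 0).ρ g x : groupCohomology (Rep.res E.i (coinduced A)) 0) : Γ → A) 1 =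
      (ev0 (Rep.res E.i (coinduced A)) x : Γ → A) (E.s g) := fun x g => by
    refine (congrFun (E.ev0_hs (coinduced A) g x) 1).trans ?_
    exact (coinduced_ρ_apply A (E.s g) _ 1).trans (by rw [one_mul])
  refine subsingleton_of_coinduced (E.hs (coinduced A) 0) (W := A)
    ((LinearMap.proj (1 : Γ) : (Γ → A) →ₗ[k] A) ∘ₗ ev0 (Rep.res E.i (coinduced A)))
    ⟨fun x y h => ?_, fun F => ?_⟩ n
  · apply ev0_injective
    funext γ
    obtain ⟨m, hm⟩ := E.exists_eq_mul γ
    have h1 := congrFun h (E.p γ)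
    have h2 := (key x (E.p γ)).symm.trans (h1.trans (key y (E.p γ)))
    have h3 := congrFun (ρ_ev0 (Rep.res E.i (coinduced A)) x m) (E.s (E.p γ))
    have h4 := congrFun (ρ_ev0 (Rep.res E.i (coinduced A)) y m) (E.s (E.p γ))
    rw [hm]
    exact h3.trans (h2.trans h4.symm)
  · obtain ⟨x, hx⟩ := exists_ev0 (Rep.res E.i (coinduced A)) (fun γ => F (E.p γ)) (fun m => by
      funext γ
      change F (E.p (γ * E.i m)) = F (E.p γ)
      rw [map_mul, E.p_i, mul_one])
    refine ⟨x, funext fun g => (key x g).trans ?_⟩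
    refine (congrFun hx (E.s g)).trans ?_
    rw [E.p_s]

end SplitExt

/-! ### The Lyndon–Hochschild–Serre inequality -/

namespace SplitExt

variable {k N Γ G : Type} [CommRing k] [Group N] [Group Γ] [Group G] (E : SplitExt N Γ G)

/-- The inclusion of the `N`-invariants of `A`, as a morphism over `Γ → G`. -/
def invHom (A : Rep.{0} k Γ) : Rep.res E.p (E.hs A 0) ⟶ A :=
  Rep.ofHom (ρ := (Rep.res E.p (E.hs A 0)).ρ) (σ := A.ρ)
    ⟨ev0 (Rep.res E.i A), fun γ => by
      refine LinearMap.ext fun x => ?_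
      obtain ⟨m, hm⟩ := E.exists_eq_mul γ
      refine (E.ev0_hs A (E.p γ) x).trans ?_
      have h1 : A.ρ γ = A.ρ (E.s (E.p γ)) ∘ₗ A.ρ (E.i m) := by
        rw [← Module.End.mul_eq_comp, ← map_mul, ← hm]
      change _ = A.ρ γ (ev0 (Rep.res E.i A) x)
      rw [h1]
      exact (congrArg (A.ρ (E.s (E.p γ))) (ρ_ev0 (Rep.res E.i A) x m)).symm⟩

/-- Exactness of the inflation-restriction sequence in degree one. -/
theorem exists_inflation (A : Rep.{0} k Γ) (x : groupCohomology A 1) (hx : E.resMap A 1 x = 0) :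
    ∃ y, groupCohomology.map E.p (E.invHom A) 1 y = x := by
  induction x using groupCohomology.H1_induction_on with | h c =>
  have h1 := congr(ConcreteCategory.hom
    $(groupCohomology.H1π_comp_map (A := A) (B := Rep.res E.i A) E.i (𝟙 (Rep.res E.i A))) c)
  obtain ⟨y, hy⟩ := (groupCohomology.H1π_eq_zero_iff _).1 (h1.symm.trans hx)
  have hyi : ∀ n, A.ρ (E.i n) y - y = c (E.i n) := fun n => congrFun hy n
  have hc := (groupCohomology.mem_cocycles₁_iff c).1 c.2
  -- Subtracting the coboundary of `y` makes the cocycle vanish on N. It is then constant on cosets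
  -- of N with N-invariant values, so it comes from G.
  obtain ⟨z, hz⟩ : ∃ z : Γ → A, ∀ γ, z γ = c γ - (A.ρ γ y - y) := ⟨_, fun _ => rfl⟩
  have hmul : ∀ a b, z (a * b) = A.ρ a (z b) + z a := fun a b => by
    have h2 : A.ρ (a * b) y = A.ρ a (A.ρ b y) := by rw [map_mul]; rfl
    rw [hz, hz, hz, hc, h2, map_sub, map_sub]
    abel
  have hi : ∀ n, z (E.i n) = 0 := fun n => by rw [hz, hyi, sub_self]
  have hp : ∀ γ, z (E.s (E.p γ)) = z γ := fun γ => by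
    obtain ⟨m, hm⟩ := E.exists_eq_mul γ
    conv_rhs => rw [hm, hmul, hi, map_zero, zero_add]
  have hinv : ∀ γ n, A.ρ (E.i n) (z γ) = z γ := fun γ n => by
    obtain ⟨m, hm⟩ := E.exists_i (γ⁻¹ * E.i n * γ) (by simp [E.p_i])
    have h2 : z (E.i n * γ) = z (γ * E.i m) := by rw [hm]; congr 1; group
    rw [hmul, hmul, hi, hi, map_zero, zero_add, add_zero] at h2
    exact h2
  choose w hw using fun g => exists_ev0 (Rep.res E.i A) (z (E.s g)) (hinv (E.s g))
  have hwc : w ∈ groupCohomology.cocycles₁ (E.hs A 0) := by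
    refine (groupCohomology.mem_cocycles₁_iff (A := E.hs A 0) w).2 fun g h => ?_
    apply ev0_injective (Rep.res E.i A)
    refine (hw _).trans ?_
    refine Eq.trans ?_ (map_add (ev0 (Rep.res E.i A)) _ _).symm
    rw [map_mul, hmul, hw]
    congr 1
    exact ((E.ev0_hs A g (w h)).trans (congrArg (A.ρ (E.s g)) (hw h))).symm
  refine ⟨groupCohomology.H1π _ ⟨w, hwc⟩, ?_⟩
  have h3 := congr(ConcreteCategory.hom
    $(groupCohomology.H1π_comp_map (A := E.hs A 0) (B := A) E.p (E.invHom A)) ⟨w, hwc⟩)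
  refine h3.trans ((groupCohomology.H1π_eq_iff _ _).2 ⟨-y, funext fun γ => ?_⟩)
  have h4 : ev0 (Rep.res E.i A) (w (E.p γ)) = z γ := (hw _).trans (hp γ)
  change A.ρ γ (-y) - -y = ev0 (Rep.res E.i A) (w (E.p γ)) - c γ
  rw [h4, hz, map_neg]
  abel

/-- The coinduced middle term has no N-cohomology in positive degrees, so the connecting map out of
degree `j + 1` is an isomorphism. -/
theorem hsδ_shift_bijective (A : Rep.{0} k Γ) (j : ℕ) :
    Function.Bijective (E.hsδ (shiftComplex_shortExact A) (j + 1)).hom := by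
  have hs := E.res_shortExact (shiftComplex_shortExact A)
  constructor
  · refine (injective_iff_map_eq_zero
      (groupCohomology.δ hs (j + 1) (j + 2) rfl).hom).2 fun x hx => ?_
    obtain ⟨y, rfl⟩ := (exact_map_δ hs (j + 1) x).1 hx
    rw [@Subsingleton.elim _ (E.subsingleton_res_coinduced A j) y 0]
    exact map_zero _
  · exact fun x => (exact_δ_map hs (j + 1) x).1
      (@Subsingleton.elim _ (E.subsingleton_res_coinduced A (j + 1)) _ _)

/-- In degree zero the shift is no longer an isomorphism: with A' the quotient of the coinduced
module by `A`, the sequence 0 → A^N → Fun(Γ, A)^N → A'^N → H^1(N, A) → 0 is exact and its second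
term is acyclic over G. -/
theorem le_hs_shift (S : SizeBound) (A : Rep.{0} k Γ) (n : ℕ) {a b : ℕ}
    (ha : S.le a (groupCohomology (E.hs A 0) (n + 2)))
    (hb : S.le b (groupCohomology (E.hs A 1) (n + 1))) :
    S.le (a + b) (groupCohomology (E.hs (shiftComplex A).X₃ 0) (n + 1)) := by
  have hs := E.res_shortExact (shiftComplex_shortExact A)
  refine S.le_of_exact₄ (E.hsMap (shiftComplex A).f 0) (E.hsMap (shiftComplex A).g 0)
    (E.hsδ (shiftComplex_shortExact A) 0) ?_ (exact_map_map hs 0) (exact_map_δ hs 0) ?_ (n + 1)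
    (E.subsingleton_hs_coinduced A n) ha hb
  · intro x y hxy
    apply ev0_injective (Rep.res E.i A)
    have h : ∀ x, ev0 (Rep.res E.i (coinduced A))
        (groupCohomology.map (.id N) ((Rep.resFunctor E.i).map (shiftComplex A).f) 0 x) =
        (toCoinduced A).hom (ev0 (Rep.res E.i A) x) :=
      fun x => ev0_map (A := Rep.res E.i A) (B := Rep.res E.i (coinduced A)) (.id N) _ x
    have hinj : Function.Injective (toCoinduced A).hom :=
      (Rep.mono_iff_injective _).1 (shiftComplex_shortExact A).mono_f
    exact hinj ((h x).symm.trans ((congrArg _ hxy).trans (h y)))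
  · exact fun x => (exact_δ_map hs 0 x).1
      (@Subsingleton.elim _ (E.subsingleton_res_coinduced A 0) _ _)

/-- The Lyndon–Hochschild–Serre bound for the kernel of restriction to the normal subgroup. -/
theorem le_ker_resMap (S : SizeBound) (n : ℕ) (A : Rep.{0} k Γ) (c : ℕ → ℕ)
    (hc : ∀ i j, i + 1 + j = n → S.le (c j) (groupCohomology (E.hs A j) (i + 1))) :
    S.le (∑ j ∈ Finset.range n, c j) (LinearMap.ker (E.resMap A n)) := by
  induction n generalizing A c with
  | zero =>
    have h : ∀ x, ev0 (Rep.res E.i A) (E.resMap A 0 x) = ev0 A x :=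
      fun x => ev0_map (A := A) (B := Rep.res E.i A) E.i (𝟙 _) x
    refine S.le_zero _ ⟨fun x y => Subtype.ext (ev0_injective A ?_)⟩
    rw [← h, ← h, LinearMap.mem_ker.1 x.2, LinearMap.mem_ker.1 y.2]
  | succ n ih =>
    rcases n with _ | n
    · rw [zero_add, Finset.sum_range_one]
      refine S.le_of_le_range (groupCohomology.map E.p (E.invHom A) 1).hom.toAddMonoidHom
        (LinearMap.ker (E.resMap A 1)).toAddSubgroup (fun x hx => ?_) (hc 0 0 rfl)
      obtain ⟨y, rfl⟩ := E.exists_inflation A x hx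
      exact ⟨y, rfl⟩
    -- Passing from `A` to the shifted module merges the terms j = 0 and j = 1 into one and lowers
    -- each later index by one; the total is unchanged.
    · let c' : ℕ → ℕ := fun j => if j = 0 then c 0 + c 1 else c (j + 1)
      have hsum : ∑ j ∈ Finset.range (n + 2), c j = ∑ j ∈ Finset.range (n + 1), c' j := by
        rw [Finset.sum_range_succ', Finset.sum_range_succ', Finset.sum_range_succ' c']
        simp only [c', if_true, Nat.add_eq_zero_iff, one_ne_zero, and_false, if_false]
        ring
      rw [hsum]
      have h := ih (shiftComplex A).X₃ c' fun i j hij => by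
        rcases j with _ | j
        · obtain rfl : i = n := by omega
          exact E.le_hs_shift S A i (hc (i + 1) 0 (by omega)) (hc i 1 (by omega))
        · refine S.le_of_injective
            (groupCohomology.map (.id G) (E.hsδ (shiftComplex_shortExact A) (j + 1))
              (i + 1)).hom.toAddMonoidHom
            (map_bijective _ (E.hsδ_shift_bijective A j) (i + 1)).1 (hc i (j + 2) (by omega))
      refine S.le_of_le_range ((groupCohomology.δ (shiftComplex_shortExact A) (n + 1) (n + 2)
        rfl).hom.toAddMonoidHom.comp (LinearMap.ker (E.resMap _ (n + 1))).subtype.toAddMonoidHom)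
        (LinearMap.ker (E.resMap A (n + 2))).toAddSubgroup (fun x hx => ?_) h
      -- A connecting preimage `y` of a class killed by restriction is itself killed by restriction,
      -- because the connecting map over N is injective here.
      obtain ⟨y, rfl⟩ := shift_δ_surjective A (n + 1) x
      refine ⟨⟨y, ?_⟩, rfl⟩
      have hs := E.res_shortExact (shiftComplex_shortExact A)
      refine (E.hsδ_shift_bijective A n).1 (Eq.trans ?_ (map_zero
        (groupCohomology.δ hs (n + 1) (n + 2) rfl).hom).symm)
      exact (E.resMap_δ (shiftComplex_shortExact A) (n + 1) y).symm.trans hx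

end SplitExt

/-- The Lyndon–Hochschild–Serre bound for the cohomology of a split extension. -/
theorem SplitExt.le_groupCohomology {k N Γ G : Type} [CommRing k] [Group N] [Group Γ] [Group G]
    (E : SplitExt N Γ G) (S : SizeBound) (n : ℕ) (A : Rep.{0} k Γ) (c : ℕ → ℕ)
    (hc : ∀ i j, i + j = n → S.le (c j) (groupCohomology (E.hs A j) i)) :
    S.le (∑ j ∈ Finset.range (n + 1), c j) (groupCohomology A n) := by
  rw [Finset.sum_range_succ]
  -- The kernel of restriction accounts for the terms with i > 0; its image lies in the invariants,
  -- the term with i = 0.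
  refine S.le_of_exact (LinearMap.ker (E.resMap A n)).subtype.toAddMonoidHom
    (E.resMap A n).toAddMonoidHom.rangeRestrict (fun x => ?_)
    (E.le_ker_resMap S n A c fun i j h => hc (i + 1) j h)
    (S.le_of_le_range (ev0 (E.hs A n)).toAddMonoidHom _ ?_ (hc 0 n (zero_add n)))
  · exact ⟨fun h => ⟨⟨x, congrArg Subtype.val h⟩, rfl⟩, by
      rintro ⟨y, rfl⟩; exact Subtype.ext y.2⟩
  · rintro _ ⟨x, rfl⟩
    exact exists_ev0 (E.hs A n) _ (E.hs_ρ_resMap A n x)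

/-! ### Order and number of generators as sizes -/

section Sizes

/-- Size measured by the binary logarithm of the cardinality. -/
def cardBound : SizeBound where
  le m M _ := Finite M ∧ Nat.card M ≤ 2 ^ m
  le_of_exact {A B C _ _ _ a b} f g hfg hA hC := by
    obtain ⟨_, hA⟩ := hA
    obtain ⟨_, hC⟩ := hC
    have hr : f.range = g.ker := (AddMonoidHom.exact_iff.1 hfg).symm
    have h1 : Nat.card g.ker ≤ 2 ^ a := by
      rw [← hr]
      exact (Nat.card_le_card_of_surjective _ f.rangeRestrict_surjective).trans hA
    have : Finite g.ker := hr ▸ Finite.of_surjective _ f.rangeRestrict_surjective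
    have h2 : Nat.card (B ⧸ g.ker) ≤ 2 ^ b :=
      (Nat.card_le_card_of_injective _ (QuotientAddGroup.kerLift_injective g)).trans hC
    have : Finite (B ⧸ g.ker) := Finite.of_injective _ (QuotientAddGroup.kerLift_injective g)
    have h3 := AddSubgroup.card_eq_card_quotient_mul_card_addSubgroup g.ker
    refine ⟨Nat.finite_of_card_ne_zero ?_, ?_⟩
    · rw [h3]
      exact mul_ne_zero Nat.card_pos.ne' Nat.card_pos.ne'
    · rw [h3, pow_add, mul_comm]
      exact Nat.mul_le_mul h1 h2
  le_zero A _ _ := ⟨inferInstance, by simp⟩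

theorem exists_surjective_subgroup {C : Type} [AddCommGroup C] {b : ℕ} (q : (Fin b → ℤ) →+ C)
    (hq : Function.Surjective q) (P : AddSubgroup C) :
    ∃ r : (Fin b → ℤ) →+ P, Function.Surjective r := by
  let Q : Submodule ℤ (Fin b → ℤ) := AddSubgroup.toIntSubmodule (P.comap q)
  obtain ⟨n, ⟨v⟩⟩ := Submodule.nonempty_basis_of_pid (Pi.basisFun ℤ (Fin b)) Q
  have hn : n ≤ b := by
    have h1 := Submodule.finrank_le Q
    rwa [Module.finrank_eq_card_basis v, Module.finrank_eq_card_basis (Pi.basisFun ℤ (Fin b)),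
      Fintype.card_fin, Fintype.card_fin] at h1
  let q' : Q →+ P := (q.comp Q.subtype.toAddMonoidHom).codRestrict P fun x => x.2
  refine ⟨q'.comp (v.equivFun.symm.toLinearMap ∘ₗ
    LinearMap.funLeft ℤ ℤ (Fin.castLE hn)).toAddMonoidHom, ?_⟩
  refine Function.Surjective.comp (g := q') ?_ (v.equivFun.symm.surjective.comp
    (LinearMap.funLeft_surjective_of_injective ℤ ℤ _ (Fin.castLE_injective hn)))
  rintro ⟨y, hy⟩
  obtain ⟨x, rfl⟩ := hq y
  exact ⟨⟨x, hy⟩, rfl⟩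

/-- Size measured by the number of generators. -/
def genBound : SizeBound where
  le m M _ := ∃ f : (Fin m → ℤ) →+ M, Function.Surjective f
  le_of_exact {A B C _ _ _ a b} f g hfg hA hC := by
    obtain ⟨p, hp⟩ := hA
    obtain ⟨q, hq⟩ := hC
    obtain ⟨r, hr⟩ := exists_surjective_subgroup q hq g.range
    choose l hl using fun i => g.rangeRestrict_surjective (r (Pi.single i 1))
    let L : (Fin b → ℤ) →ₗ[ℤ] B := (Pi.basisFun ℤ (Fin b)).constr ℤ l
    have hL : ∀ v, g.rangeRestrict (L v) = r v := fun v => by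
      have : g.rangeRestrict.toIntLinearMap ∘ₗ L = r.toIntLinearMap := by
        refine (Pi.basisFun ℤ (Fin b)).ext fun i => ?_
        simpa [L] using hl i
      exact LinearMap.congr_fun this v
    refine ⟨(f.comp p).comp (LinearMap.funLeft ℤ ℤ (Fin.castAdd b)).toAddMonoidHom +
      L.toAddMonoidHom.comp (LinearMap.funLeft ℤ ℤ (Fin.natAdd a)).toAddMonoidHom, fun x => ?_⟩
    obtain ⟨v, hv⟩ := hr (g.rangeRestrict x)
    have h1 : g (x - L v) = 0 := by
      rw [map_sub, sub_eq_zero]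
      exact congrArg Subtype.val (hv.symm.trans (hL v).symm)
    obtain ⟨y, hy⟩ := (hfg _).1 h1
    obtain ⟨u, rfl⟩ := hp y
    refine ⟨Fin.append u v, ?_⟩
    have h2 : LinearMap.funLeft ℤ ℤ (Fin.castAdd b) (Fin.append u v) = u := by
      ext i; simp [LinearMap.funLeft]
    have h3 : LinearMap.funLeft ℤ ℤ (Fin.natAdd a) (Fin.append u v) = v := by
      ext i; simp [LinearMap.funLeft]
    change f (p (LinearMap.funLeft ℤ ℤ (Fin.castAdd b) (Fin.append u v))) +
      L (LinearMap.funLeft ℤ ℤ (Fin.natAdd a) (Fin.append u v)) = x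
    rw [h2, h3, hy, sub_add_cancel]
  le_zero A _ _ := ⟨0, fun x => ⟨0, Subsingleton.elim _ _⟩⟩

/-- Composing with ℤ^m → M gives a surjective endomorphism of ℤ^m, which is injective. -/
theorem bijective_of_genBound {M : Type} [AddCommGroup M] {m : ℕ} (h : genBound.le m M)
    (F : M →+ (Fin m → ℤ)) (hF : Function.Surjective F) : Function.Bijective F := by
  obtain ⟨f, hf⟩ := h
  refine ⟨fun x y hxy => ?_, hF⟩
  obtain ⟨u, rfl⟩ := hf x
  obtain ⟨v, rfl⟩ := hf y
  exact congrArg f (OrzechProperty.injective_of_surjective_endomorphism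
    (F.comp f).toIntLinearMap (hF.comp hf) hxy)

end Sizes

/-! ### Cohomology of ℤ and generators for the cohomology of ℤ^n -/

section InfiniteCyclic

variable {k : Type} [CommRing k]

theorem exists_int_recursion {B : Type} (σ : ℤ → B ≃ B) (b : B) :
    ∃ φ : ℤ → B, ∀ n, φ (n + 1) = σ n (φ n) := by
  let φ : ℤ → B := fun n => Int.casesOn n (fun n => Nat.rec b (fun m x => σ m x) n)
    (fun n => Nat.rec ((σ (-1)).symm b) (fun m x => (σ (-(m + 1 : ℕ) - 1)).symm x) n)
  refine ⟨φ, fun n => ?_⟩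
  rcases n with n | n
  · rfl
  · rcases n with _ | n
    · exact ((σ (-1)).apply_symm_apply b).symm
    · have h1 : Int.negSucc (n + 1) + 1 = Int.negSucc n := by omega
      have h2 : Int.negSucc (n + 1) = -(n + 1 : ℕ) - 1 := by omega
      rw [h1]
      have h3 : φ (Int.negSucc (n + 1)) = (σ (-(n + 1 : ℕ) - 1)).symm (φ (Int.negSucc n)) := rfl
      rw [h3, h2, Equiv.apply_symm_apply]

variable (B : Rep.{0} k (Multiplicative ℤ))

/-- With D f(s) = f(st) − t f(s), the sequence 0 → B → Fun(ℤ, B) → Fun(ℤ, B) → 0 is a coinduced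
resolution of length one. -/
theorem subsingleton_infiniteCyclic (n : ℕ) : Subsingleton (groupCohomology B (n + 2)) := by
  let t : Multiplicative ℤ := Multiplicative.ofAdd 1
  let D : coinduced B ⟶ coinduced B :=
    Rep.ofHom (ρ := (coinduced B).ρ) (σ := (coinduced B).ρ)
      ⟨LinearMap.funLeft k B (· * t) - (B.ρ t).compLeft (Multiplicative ℤ), fun g => by
        refine LinearMap.ext fun f => funext fun s => ?_
        change f (s * t * g) - B.ρ t (f (s * g)) = f (s * g * t) - B.ρ t (f (s * g))
        rw [mul_right_comm]⟩
  have hD : ∀ (f : Multiplicative ℤ → B) s, (D.hom f : Multiplicative ℤ → B) s =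
    f (s * t) - B.ρ t (f s) := fun f s => rfl
  have hmul : ∀ (a b : Multiplicative ℤ) x, B.ρ (a * b) x = B.ρ a (B.ρ b x) := fun a b x => by
    rw [map_mul]; rfl
  have hs := shortExact_of (toCoinduced B) D
    ((Rep.mono_iff_injective _).1 (shiftComplex_shortExact B).mono_f)
    (fun f => by
      constructor
      · intro hf
        have hf' : ∀ s, (f : Multiplicative ℤ → B) (s * t) =
            B.ρ t ((f : Multiplicative ℤ → B) s) := fun s =>
          sub_eq_zero.1 ((hD f s).symm.trans (congrFun hf s))
        refine ⟨(f : Multiplicative ℤ → B) 1, funext fun s => ?_⟩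
        refine (toCoinduced_apply B _ s).trans ?_
        suffices h : ∀ n : ℤ, B.ρ (Multiplicative.ofAdd n) ((f : Multiplicative ℤ → B) 1) =
          (f : Multiplicative ℤ → B) (Multiplicative.ofAdd n) from h s.toAdd
        intro n
        induction n using Int.induction_on with
        | zero =>
          have h1 : B.ρ 1 ((f : Multiplicative ℤ → B) 1) = (f : Multiplicative ℤ → B) 1 := by
            rw [map_one]; rfl
          exact h1
        | succ n ih => rw [ofAdd_add, hf', ← ih, ← hmul, mul_comm]
        | pred n ih =>
          have h2 := hf' (Multiplicative.ofAdd (-(n : ℤ) - 1))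
          have h3 : Multiplicative.ofAdd (-(n : ℤ) - 1) * t = Multiplicative.ofAdd (-(n : ℤ)) := by
            rw [← ofAdd_add, sub_add_cancel]
          rw [h3, ← ih, ← h3, mul_comm, hmul] at h2
          have h4 : ∀ x, B.ρ t⁻¹ (B.ρ t x) = x := fun x => by
            rw [← hmul, inv_mul_cancel, map_one]; rfl
          exact (h4 _).symm.trans ((congrArg _ h2).trans (h4 _))
      · rintro ⟨a, rfl⟩
        refine funext fun s => (hD _ s).trans (sub_eq_zero.2 ?_)
        refine (toCoinduced_apply B a (s * t)).trans ?_
        rw [mul_comm, hmul]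
        rfl)
    -- Surjectivity of `D`: f(st) = t f(s) + r(s) is solved recursively in both directions from the
    -- value 0, since `t` acts invertibly.
    (fun r => by
      obtain ⟨φ, hφ⟩ := exists_int_recursion
        (fun n =>
          ((MulAction.toPerm (Units.mk (B.ρ t) (B.ρ t⁻¹) (by rw [← map_mul]; simp)
            (by rw [← map_mul]; simp)) : B ≃ B).trans
            (Equiv.addRight ((r : Multiplicative ℤ → B) (Multiplicative.ofAdd n))))) 0
      refine ⟨fun s => φ s.toAdd, funext fun s => ?_⟩
      exact sub_eq_iff_eq_add'.2 (hφ s.toAdd))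
  refine subsingleton_of_forall_eq 0 fun x => ?_
  obtain ⟨y, rfl⟩ := (exact_δ_map hs (n + 1) x).1
    (@Subsingleton.elim _ (subsingleton_coinduced B (n + 1)) _ _)
  rw [@Subsingleton.elim _ (subsingleton_coinduced B n) y 0]
  exact map_zero _

theorem le_infiniteCyclic_zero (S : SizeBound) {a : ℕ} (h : S.le a B) :
    S.le a (groupCohomology B 0) :=
  S.le_of_injective (ev0 B).toAddMonoidHom (ev0_injective B) h

theorem le_infiniteCyclic_one (S : SizeBound) {a : ℕ} (h : S.le a B) :
    S.le a (groupCohomology B 1) := by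
  let t : Multiplicative ℤ := Multiplicative.ofAdd 1
  have hsurj : Function.Surjective (groupCohomology.H1π B) := fun x => by
    induction x using groupCohomology.H1_induction_on with | h c => exact ⟨c, rfl⟩
  refine S.le_of_surjective (groupCohomology.H1π B).hom.toAddMonoidHom hsurj
    (S.le_of_injective ((LinearMap.proj t).comp
      (groupCohomology.cocycles₁ B).subtype).toAddMonoidHom ?_ h)
  refine (injective_iff_map_eq_zero _).2 fun c hc => ?_
  have h1 : c t = 0 := hc
  have h2 := (groupCohomology.mem_cocycles₁_iff c).1 c.2
  refine groupCohomology.cocycles₁_ext fun s => ?_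
  suffices h : ∀ n : ℤ, c (Multiplicative.ofAdd n) = 0 from h s.toAdd
  intro n
  induction n using Int.induction_on with
  | zero => exact groupCohomology.cocycles₁_map_one c
  | succ n ih => rw [ofAdd_add, h2, ih, h1, map_zero, add_zero]
  | pred n ih =>
    have h3 := h2 (Multiplicative.ofAdd (-(n : ℤ) - 1)) t
    rw [← ofAdd_add, sub_add_cancel, ih, h1, map_zero, zero_add] at h3
    exact h3.symm

end InfiniteCyclic

/-- `ℤ^{n+1} = ℤ × ℤ^n`. -/
def latticeSplit (n : ℕ) :
    SplitExt (Multiplicative (Fin n → ℤ)) (Multiplicative (Fin (n + 1) → ℤ))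
      (Multiplicative ℤ) where
  i := AddMonoidHom.toMultiplicative
    { toFun v := (Fin.cons 0 v : Fin (n + 1) → ℤ)
      map_zero' := by
        funext i
        refine Fin.cases ?_ (fun i => ?_) i <;> simp
      map_add' v w := by
        funext i
        refine Fin.cases ?_ (fun i => ?_) i <;> simp }
  s := AddMonoidHom.toMultiplicative (AddMonoidHom.single (fun _ : Fin (n + 1) => ℤ) 0)
  p := AddMonoidHom.toMultiplicative (Pi.evalAddMonoidHom (fun _ : Fin (n + 1) => ℤ) 0)
  i_injective v w h := Fin.cons_right_injective (α := fun _ : Fin (n + 1) => ℤ) 0 h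
  p_s t := Pi.single_eq_same (M := fun _ : Fin (n + 1) => ℤ) 0 t.toAdd
  p_i v := rfl
  exists_i x hx := by
    refine ⟨Multiplicative.ofAdd (Fin.tail x.toAdd), ?_⟩
    have h : x.toAdd 0 = 0 := hx
    change (Fin.cons 0 (Fin.tail x.toAdd) : Fin (n + 1) → ℤ) = x.toAdd
    rw [← h, Fin.cons_self_tail]

/-- Induction along ℤ^{n+1} = ℤ × ℤ^n: only H^0 and H^1 of ℤ contribute, and Pascal's rule adds the
two bounds. -/
theorem gen_lattice (n j : ℕ) : genBound.le (n.choose j)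
    (groupCohomology (Rep.trivial ℤ (Multiplicative (Fin n → ℤ)) ℤ) j) := by
  induction n generalizing j with
  | zero =>
    rcases j with _ | j
    · refine genBound.le_of_injective (ev0 _).toAddMonoidHom (ev0_injective _) ?_
      exact ⟨Pi.evalAddMonoidHom (fun _ : Fin 1 => ℤ) 0, fun x => ⟨fun _ => x, rfl⟩⟩
    · rw [Nat.choose_zero_succ]
      have : Subsingleton (Multiplicative (Fin 0 → ℤ)) :=
        inferInstanceAs (Subsingleton (Fin 0 → ℤ))
      exact genBound.le_zero _ (ModuleCat.subsingleton_of_isZero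
        (isZero_groupCohomology_succ_of_subsingleton _ j))
  | succ n ih =>
    let c : ℕ → ℕ := fun l => if l = j then n.choose l else if l + 1 = j then n.choose l else 0
    have hsum : (n + 1).choose j = ∑ l ∈ Finset.range (j + 1), c l := by
      rcases j with _ | j
      · simp [c]
      · rw [Finset.sum_range_succ, Finset.sum_range_succ, Finset.sum_eq_zero, Nat.choose_succ_succ]
        · simp [c]
        · intro l hl
          have := Finset.mem_range.1 hl
          simp only [c]
          rw [if_neg (by omega), if_neg (by omega)]
    rw [hsum]
    refine (latticeSplit n).le_groupCohomology genBound j (Rep.trivial ℤ _ ℤ) c fun i l h => ?_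
    rcases i with _ | _ | i
    · have hc : c l = n.choose l := if_pos (by omega)
      rw [hc]
      exact le_infiniteCyclic_zero _ genBound (ih l)
    · have hc : c l = n.choose l := by simp only [c]; rw [if_neg (by omega), if_pos (by omega)]
      rw [hc]
      exact le_infiniteCyclic_one _ genBound (ih l)
    · have hc : c l = 0 := by simp only [c]; rw [if_neg (by omega), if_neg (by omega)]
      rw [hc]
      exact genBound.le_zero _ (subsingleton_infiniteCyclic _ i)

/-! ### Coordinates on the cohomology of a lattice -/

section Alternation

variable {N : Type}

/-- The value at `l` of the antisymmetrization of a cochain. -/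
def altF {j : ℕ} (l : Fin j → N) : ((Fin j → N) → ℤ) →ₗ[ℤ] ℤ :=
  ∑ σ : Equiv.Perm (Fin j), (Equiv.Perm.sign σ : ℤ) • LinearMap.proj (l ∘ σ)

theorem altF_apply {j : ℕ} (l : Fin j → N) (c : (Fin j → N) → ℤ) :
    altF l c = ∑ σ : Equiv.Perm (Fin j), (Equiv.Perm.sign σ : ℤ) * c (l ∘ σ) := by
  simp [altF]

variable [CommGroup N]

theorem contractNth_last {n : ℕ} (h : Fin (n + 1) → N) :
    Fin.contractNth (Fin.last n) (· * ·) h = h ∘ Fin.castSucc := by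
  funext i
  exact Fin.contractNth_apply_of_lt _ _ _ _ i.2

theorem contractNth_swap {n : ℕ} (h : Fin (n + 1) → N) (t : Fin n) :
    Fin.contractNth t.castSucc (· * ·) (h ∘ Equiv.swap t.castSucc t.succ) =
      Fin.contractNth t.castSucc (· * ·) h := by
  funext i
  rcases lt_trichotomy (i : ℕ) t with hi | hi | hi
  · rw [Fin.contractNth_apply_of_lt _ _ _ _ hi, Fin.contractNth_apply_of_lt _ _ _ _ hi,
      Function.comp_apply, Equiv.swap_apply_of_ne_of_ne]
    · exact fun h => by simp [Fin.ext_iff] at h; omega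
    · exact fun h => by simp [Fin.ext_iff] at h; omega
  · obtain rfl : i = t := Fin.ext hi
    rw [Fin.contractNth_apply_of_eq _ _ _ _ hi, Fin.contractNth_apply_of_eq _ _ _ _ hi]
    simp [mul_comm]
  · rw [Fin.contractNth_apply_of_gt _ _ _ _ hi, Fin.contractNth_apply_of_gt _ _ _ _ hi,
      Function.comp_apply, Equiv.swap_apply_of_ne_of_ne]
    · exact fun h => by simp [Fin.ext_iff] at h; omega
    · exact fun h => by simp [Fin.ext_iff] at h; omega

/-- By commutativity the inner face at `t` is unchanged under swapping the entries t and t + 1, so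
its signed sum vanishes. The two outer faces differ by a rotation of sign (−1)^n and cancel. -/
theorem altF_d {n : ℕ} (l : Fin (n + 1) → N) (c : (Fin n → N) → ℤ) :
    altF l (inhomogeneousCochains.d (Rep.trivial ℤ N ℤ) n c) = 0 := by
  rw [altF_apply]
  have hd : ∀ h : Fin (n + 1) → N, inhomogeneousCochains.d (Rep.trivial ℤ N ℤ) n c h =
      c (h ∘ Fin.succ) + (∑ t : Fin n, (-1 : ℤ) ^ ((t : ℕ) + 1) *
        c (Fin.contractNth t.castSucc (· * ·) h) + (-1 : ℤ) ^ (n + 1) * c (h ∘ Fin.castSucc)) := by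
    intro h
    rw [inhomogeneousCochains.d_hom_apply, Fin.sum_univ_castSucc, contractNth_last]
    rfl
  simp only [hd, mul_add, Finset.sum_add_distrib]
  have h1 : ∑ σ : Equiv.Perm (Fin (n + 1)), (Equiv.Perm.sign σ : ℤ) *
      ∑ t : Fin n, (-1 : ℤ) ^ ((t : ℕ) + 1) * c (Fin.contractNth t.castSucc (· * ·) (l ∘ σ)) = 0 := by
    simp only [Finset.mul_sum]
    rw [Finset.sum_comm]
    refine Finset.sum_eq_zero fun t _ => ?_
    have h2 := Equiv.sum_comp (Equiv.mulRight (Equiv.swap t.castSucc t.succ))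
      (fun σ : Equiv.Perm (Fin (n + 1)) => (Equiv.Perm.sign σ : ℤ) *
        ((-1 : ℤ) ^ ((t : ℕ) + 1) * c (Fin.contractNth t.castSucc (· * ·) (l ∘ σ))))
    have h3 : ∀ σ : Equiv.Perm (Fin (n + 1)),
        (Equiv.Perm.sign (σ * Equiv.swap t.castSucc t.succ) : ℤ) *
          ((-1 : ℤ) ^ ((t : ℕ) + 1) * c (Fin.contractNth t.castSucc (· * ·)
            (l ∘ (σ * Equiv.swap t.castSucc t.succ : Equiv.Perm (Fin (n + 1)))))) =
        -((Equiv.Perm.sign σ : ℤ) *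
        ((-1 : ℤ) ^ ((t : ℕ) + 1) * c (Fin.contractNth t.castSucc (· * ·) (l ∘ σ)))) := by
      intro σ
      rw [Equiv.Perm.coe_mul, ← Function.comp_assoc, contractNth_swap, map_mul,
        Equiv.Perm.sign_swap (Fin.castSucc_lt_succ).ne]
      simp
    simp only [Equiv.coe_mulRight, h3, Finset.sum_neg_distrib] at h2
    omega
  have h4 : ∑ σ : Equiv.Perm (Fin (n + 1)), (Equiv.Perm.sign σ : ℤ) * c ((l ∘ σ) ∘ Fin.succ) =
      (-1) ^ n * ∑ σ : Equiv.Perm (Fin (n + 1)),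
        (Equiv.Perm.sign σ : ℤ) * c ((l ∘ σ) ∘ Fin.castSucc) := by
    rw [← Equiv.sum_comp (Equiv.mulRight (finRotate (n + 1))) (fun σ : Equiv.Perm (Fin (n + 1)) =>
      (Equiv.Perm.sign σ : ℤ) * c ((l ∘ σ) ∘ Fin.castSucc)), Finset.mul_sum]
    refine Finset.sum_congr rfl fun σ _ => ?_
    have h5 : (l ∘ (σ * finRotate (n + 1) : Equiv.Perm (Fin (n + 1)))) ∘ Fin.castSucc =
        (l ∘ σ) ∘ Fin.succ := by
      funext i
      simp
    simp only [Equiv.coe_mulRight, h5, map_mul, sign_finRotate]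
    have h6 : ((-1 : ℤ) ^ n) * (-1) ^ n = 1 := by rw [← mul_pow]; simp
    push_cast
    linear_combination -((Equiv.Perm.sign σ : ℤ) * c ((l ∘ σ) ∘ Fin.succ)) * h6
  have h7 : ∑ σ : Equiv.Perm (Fin (n + 1)), (Equiv.Perm.sign σ : ℤ) *
      ((-1 : ℤ) ^ (n + 1) * c ((l ∘ σ) ∘ Fin.castSucc)) = (-1) ^ (n + 1) *
      ∑ σ : Equiv.Perm (Fin (n + 1)), (Equiv.Perm.sign σ : ℤ) * c ((l ∘ σ) ∘ Fin.castSucc) := by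
    rw [Finset.mul_sum]
    exact Finset.sum_congr rfl fun σ _ => by ring
  rw [h1, h4, h7]
  ring

end Alternation

section ProductCocycle

variable {N : Type} [Group N]

/-- The cochain `(g₁, …, g_j) ↦ φ₁(g₁) ⋯ φ_j(g_j)`. -/
def prodCochain {j : ℕ} (φ : Fin j → N →* Multiplicative ℤ) (g : Fin j → N) : ℤ :=
  ∏ i, (φ i (g i)).toAdd

theorem prodCochain_contractNth {n : ℕ} (φ : Fin n → N →* Multiplicative ℤ) (g : Fin (n + 1) → N)
    (t : Fin n) : prodCochain φ (Fin.contractNth t.castSucc (· * ·) g) =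
      prodCochain φ (t.castSucc.removeNth g) + prodCochain φ (t.succ.removeNth g) := by
  have hc : ∀ i, i ≠ t → Fin.contractNth t.castSucc (· * ·) g i = t.castSucc.removeNth g i ∧
      Fin.contractNth t.castSucc (· * ·) g i = t.succ.removeNth g i := by
    intro i hi
    rcases lt_or_gt_of_ne hi with h | h
    · rw [Fin.contractNth_apply_of_lt _ _ _ _ h, Fin.removeNth, Fin.removeNth,
        Fin.succAbove_of_castSucc_lt _ _ h,
        Fin.succAbove_of_castSucc_lt _ _ ((Fin.castSucc_lt_castSucc_iff.2 h).trans Fin.castSucc_lt_succ)]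
      exact ⟨rfl, rfl⟩
    · rw [Fin.contractNth_apply_of_gt _ _ _ _ h, Fin.removeNth, Fin.removeNth,
        Fin.succAbove_of_le_castSucc _ _ h.le, Fin.succAbove_of_le_castSucc _ _ h]
      exact ⟨rfl, rfl⟩
  have ht : (φ t (Fin.contractNth t.castSucc (· * ·) g t)).toAdd =
      (φ t (t.castSucc.removeNth g t)).toAdd + (φ t (t.succ.removeNth g t)).toAdd := by
    rw [Fin.contractNth_apply_of_eq _ _ _ _ rfl, Fin.removeNth, Fin.removeNth,
      Fin.succAbove_of_le_castSucc _ _ le_rfl, Fin.succAbove_of_castSucc_lt _ _ Fin.castSucc_lt_succ,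
      map_mul, toAdd_mul, add_comm]
  simp only [prodCochain]
  rw [← Finset.mul_prod_erase _ _ (Finset.mem_univ t), ht, add_mul,
    ← Finset.mul_prod_erase _ _ (Finset.mem_univ t),
    ← Finset.mul_prod_erase (a := t) _ (fun i => (φ i (t.succ.removeNth g i)).toAdd)
      (Finset.mem_univ t)]
  congr 2
  · exact Finset.prod_congr rfl fun i hi => by rw [(hc i (Finset.ne_of_mem_erase hi)).1]
  · exact Finset.prod_congr rfl fun i hi => by rw [(hc i (Finset.ne_of_mem_erase hi)).2]

/-- Each inner face splits as the sum of two cochains that omit one argument, and the alternating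
sum telescopes. -/
theorem d_prodCochain {n : ℕ} (φ : Fin n → N →* Multiplicative ℤ) :
    inhomogeneousCochains.d (Rep.trivial ℤ N ℤ) n (prodCochain φ) = 0 := by
  funext g
  have hlast : Fin.contractNth (Fin.last n) (· * ·) g = (Fin.last n).removeNth g := by
    funext i
    rw [Fin.contractNth_apply_of_lt _ _ _ _ i.2, Fin.removeNth, Fin.succAbove_last]
  have h : inhomogeneousCochains.d (Rep.trivial ℤ N ℤ) n (prodCochain φ) g =
      prodCochain φ ((0 : Fin (n + 1)).removeNth g) + (∑ t : Fin n, (-1 : ℤ) ^ ((t : ℕ) + 1) *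
        prodCochain φ (Fin.contractNth t.castSucc (· * ·) g) +
          (-1 : ℤ) ^ (n + 1) * prodCochain φ ((Fin.last n).removeNth g)) := by
    rw [inhomogeneousCochains.d_hom_apply, Fin.sum_univ_castSucc, hlast]
    rfl
  refine h.trans ?_
  have hsum : ∑ t : Fin n, (-1 : ℤ) ^ ((t : ℕ) + 1) *
      prodCochain φ (Fin.contractNth t.castSucc (· * ·) g) =
      ∑ t : Fin n, (-1 : ℤ) ^ ((t.succ : Fin (n + 1)) : ℕ) * prodCochain φ (t.succ.removeNth g) -
      ∑ t : Fin n, (-1 : ℤ) ^ ((t.castSucc : Fin (n + 1)) : ℕ) *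
        prodCochain φ (t.castSucc.removeNth g) := by
    rw [← Finset.sum_sub_distrib]
    refine Finset.sum_congr rfl fun t _ => ?_
    rw [prodCochain_contractNth, Fin.val_succ, Fin.val_castSucc]
    ring
  have h1 := Fin.sum_univ_succ
    (fun t : Fin (n + 1) => (-1 : ℤ) ^ (t : ℕ) * prodCochain φ (t.removeNth g))
  have h2 := Fin.sum_univ_castSucc
    (fun t : Fin (n + 1) => (-1 : ℤ) ^ (t : ℕ) * prodCochain φ (t.removeNth g))
  rw [hsum]
  simp only [Fin.val_zero, pow_zero, one_mul, Fin.val_last] at h1 h2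
  rw [pow_succ]
  change _ = (0 : ℤ)
  linarith

theorem altF_prodCochain {j : ℕ} (l : Fin j → N) (φ : Fin j → N →* Multiplicative ℤ) :
    altF l (prodCochain φ) = Matrix.det (Matrix.of fun a i => (φ i (l a)).toAdd) := by
  rw [altF_apply, Matrix.det_apply]
  refine Finset.sum_congr rfl fun σ _ => ?_
  rw [Units.smul_def, smul_eq_mul]
  rfl

end ProductCocycle

section CoordinateBasis

variable {A : Type} [AddCommGroup A] {m : ℕ} (f : A →+ (Fin m → ℤ)) (c : Fin m → A)
theorem surjective_of_single (hc : ∀ b, f (c b) = Pi.single b 1) : Function.Surjective f := by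
  intro w
  refine ⟨∑ b, w b • c b, ?_⟩
  rw [map_sum]
  simp only [map_zsmul, hc]
  funext a
  simp [Finset.sum_apply, Pi.single_apply]

theorem mulVec_of_single (hc : ∀ b, f (c b) = Pi.single b 1) (hf : Function.Injective f)
    (T : A →+ A) (C : Matrix (Fin m) (Fin m) ℤ)
    (hT : ∀ b, f (T (c b)) = C.mulVec (Pi.single b 1)) (x : A) : f (T x) = C.mulVec (f x) := by
  have hx : x = ∑ b, f x b • c b := by
    apply hf
    rw [map_sum]
    simp only [map_zsmul, hc]
    funext a
    simp [Finset.sum_apply, Pi.single_apply]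
  have h1 : f (T x) = ∑ b, f x b • f (T (c b)) := by
    conv_lhs => rw [hx]
    simp only [map_sum, map_zsmul]
  rw [h1]
  simp only [hT]
  funext a
  simp [Finset.sum_apply, Matrix.mulVec, dotProduct, mul_comm]

end CoordinateBasis

section LatticeCohomology

variable {n q m : ℕ}

/-- The matrix of the minors of `M` with the given families of rows and columns. -/
def compound (M : Matrix (Fin n) (Fin n) ℤ) (v : Fin m → Fin q → Fin n) :
    Matrix (Fin m) (Fin m) ℤ :=
  Matrix.of fun a b => Matrix.det (Matrix.of fun k i => M (v a k) (v b i))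

/-- Basis vectors of the lattice. -/
def stdVec (i : Fin n) : Multiplicative (Fin n → ℤ) := Multiplicative.ofAdd (Pi.single i 1)

/-- Coordinate functions of the lattice. -/
def coordHom (i : Fin n) : Multiplicative (Fin n → ℤ) →* Multiplicative ℤ :=
  AddMonoidHom.toMultiplicative (Pi.evalAddMonoidHom (fun _ : Fin n => ℤ) i)

/-- The class of the product of the coordinate functions with indices `b`. -/
def coordClass (b : Fin q → Fin n) :
    groupCohomology (Rep.trivial ℤ (Multiplicative (Fin n → ℤ)) ℤ) q :=
  cls (prodCochain fun i => coordHom (b i)) (d_prodCochain _)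

/-- Antisymmetrized values on the basis vectors with the given families of indices. -/
def coordMap (v : Fin m → Fin (q + 1) → Fin n) :
    groupCohomology (Rep.trivial ℤ (Multiplicative (Fin n → ℤ)) ℤ) (q + 1) →+ (Fin m → ℤ) :=
  AddMonoidHom.mk' (fun x a => descend (A := Rep.trivial ℤ (Multiplicative (Fin n → ℤ)) ℤ)
    (altF fun k => stdVec (v a k)) (altF_d _) x) fun x y => funext fun a =>
      map_add (descend (A := Rep.trivial ℤ (Multiplicative (Fin n → ℤ)) ℤ)
        (altF fun k => stdVec (v a k)) (altF_d _)) x y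

theorem coordMap_cls (v : Fin m → Fin (q + 1) → Fin n)
    (φ : Fin (q + 1) → Multiplicative (Fin n → ℤ) →* Multiplicative ℤ) (h) (a : Fin m) :
    coordMap v (cls (A := Rep.trivial ℤ (Multiplicative (Fin n → ℤ)) ℤ) (prodCochain φ) h) a =
      Matrix.det (Matrix.of fun k i => (φ i (stdVec (v a k))).toAdd) :=
  (descend_cls (A := Rep.trivial ℤ (Multiplicative (Fin n → ℤ)) ℤ)
    (altF fun k => stdVec (v a k)) (altF_d _) (prodCochain φ) h).trans (altF_prodCochain _ _)

theorem coordMap_coordClass (v : Fin m → Fin (q + 1) → Fin n)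
    (hv : compound 1 v = 1) (b : Fin m) :
    coordMap v (coordClass (v b)) = Pi.single b 1 := by
  funext a
  refine (coordMap_cls v _ _ a).trans ?_
  have h1 : (1 : Matrix (Fin m) (Fin m) ℤ) a b = (Pi.single b 1 : Fin m → ℤ) a := by
    rw [Matrix.one_apply, Pi.single_apply]
  rw [← h1, ← hv]
  refine congrArg Matrix.det ?_
  funext k i
  change (Pi.single (v a k) 1 : Fin n → ℤ) (v b i) = (1 : Matrix (Fin n) (Fin n) ℤ) (v a k) (v b i)
  rw [Matrix.one_apply, Pi.single_apply]
  exact if_congr eq_comm rfl rfl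

/-- The condition `compound 1 v = 1` makes the products of coordinates dual to the evaluations, so
the map is onto; the generator bound does the rest. -/
theorem coordMap_bijective (hm : m = n.choose (q + 1)) (v : Fin m → Fin (q + 1) → Fin n)
    (hv : compound 1 v = 1) : Function.Bijective (coordMap v) :=
  bijective_of_genBound (hm ▸ gen_lattice n (q + 1)) (coordMap v)
    (surjective_of_single _ _ (coordMap_coordClass v hv))

variable {G : Type} [Group G]

/-- The action on the cohomology of a lattice is by minors. -/
theorem coordMap_cohomologyRep (ρ : Representation ℤ G (Fin n → ℤ)) (hm : m = n.choose (q + 1))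
    (v : Fin m → Fin (q + 1) → Fin n)
    (hv : compound 1 v = 1) (g : G) (M : Matrix (Fin n) (Fin n) ℤ)
    (hM : ∀ i, ρ g⁻¹ (Pi.single i 1) = M i) (C : Matrix (Fin m) (Fin m) ℤ)
    (hC : compound M v = C)
    (x : groupCohomology (Rep.trivial ℤ (Multiplicative (Fin n → ℤ)) ℤ) (q + 1)) :
    coordMap v ((cohomologyRep ρ (q + 1)).ρ g x) = C.mulVec (coordMap v x) := by
  refine mulVec_of_single (coordMap v) (fun b => coordClass (v b)) (coordMap_coordClass v hv)
    (coordMap_bijective hm v hv).1 ((cohomologyRep ρ (q + 1)).ρ g).toAddMonoidHom C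
    (fun b => ?_) x
  have h1 : (cohomologyRep ρ (q + 1)).ρ g (coordClass (v b)) =
      cls (A := Rep.trivial ℤ (Multiplicative (Fin n → ℤ)) ℤ) (prodCochain fun i =>
        (coordHom (v b i)).comp (latticeAut ρ g⁻¹).toMonoidHom) (d_prodCochain _) :=
    map_cls (A := Rep.trivial ℤ (Multiplicative (Fin n → ℤ)) ℤ)
      (B := Rep.trivial ℤ (Multiplicative (Fin n → ℤ)) ℤ) _ _ _ _ (d_prodCochain fun i =>
        (coordHom (v b i)).comp (latticeAut ρ g⁻¹).toMonoidHom)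
  refine (congrArg (coordMap v) h1).trans ?_
  funext a
  rw [coordMap_cls, Matrix.mulVec_single_one, Matrix.col_apply, ← hC]
  refine congrArg Matrix.det ?_
  funext k i
  exact congrFun (hM (v a k)) (v b i)

end LatticeCohomology

/-! ### Cohomology of a cyclic group from integer matrices -/

section Quotient

variable {K B H : Type} [AddCommGroup K] [AddCommGroup B] [AddCommGroup H] {m : ℕ}

/-- Identification of a quotient `ker P / im Q` of integral matrices with a cyclic group by means
of a linear form `r`. -/
theorem nonempty_addEquiv_zmod (e : B →+ (Fin m → ℤ)) (he : Function.Bijective e) (p q : B → B)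
    (P Q : Matrix (Fin m) (Fin m) ℤ) (hp : ∀ b, e (p b) = P.mulVec (e b))
    (hq : ∀ b, e (q b) = Q.mulVec (e b)) (ι : K →+ B)
    (hι : ∀ b, b ∈ Set.range ι ↔ p b = 0) (π : K →+ H) (hπ : Function.Surjective π)
    (hker : ∀ x, π x = 0 ↔ ι x ∈ Set.range q) (d : ℕ) (r : Fin m → ℤ)
    (h1 : ∀ u, (d : ℤ) ∣ r ⬝ᵥ Q.mulVec u)
    (h2 : ∀ w, P.mulVec w = 0 → (d : ℤ) ∣ r ⬝ᵥ w → ∃ u, Q.mulVec u = w)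
    (w₀ : Fin m → ℤ) (hw : P.mulVec w₀ = 0) (hr : (d : ℤ) ∣ r ⬝ᵥ w₀ - 1) :
    Nonempty (H ≃+ ZMod d) := by
  let t : K →+ ZMod d := AddMonoidHom.mk' (fun x => ((r ⬝ᵥ e (ι x) : ℤ) : ZMod d)) fun x y => by
    rw [map_add, map_add, dotProduct_add, Int.cast_add]
  have ht0 : ∀ x, t x = 0 ↔ (d : ℤ) ∣ r ⬝ᵥ e (ι x) := fun x => ZMod.intCast_zmod_eq_zero_iff_dvd _ _
  have hp0 : p (0 : B) = 0 := he.1 (by rw [hp, map_zero, Matrix.mulVec_zero])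
  have ht : Function.Surjective t := by
    obtain ⟨b, hb⟩ := he.2 w₀
    have hb0 : p b = 0 := he.1 (by rw [hp, hb, hw, map_zero])
    obtain ⟨x, hx⟩ := (hι b).2 hb0
    have h3 : t x = 1 := by
      have h4 : ((r ⬝ᵥ w₀ - 1 : ℤ) : ZMod d) = 0 := (ZMod.intCast_zmod_eq_zero_iff_dvd _ _).2 hr
      rw [Int.cast_sub, Int.cast_one, sub_eq_zero] at h4
      rw [← h4, ← hb, ← hx]
      rfl
    intro z
    obtain ⟨c, hc⟩ := ZMod.intCast_surjective z
    refine ⟨c • x, ?_⟩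
    rw [map_zsmul, h3, zsmul_one, hc]
  have hk : π.ker = t.ker := by
    ext x
    rw [AddMonoidHom.mem_ker, AddMonoidHom.mem_ker, hker, ht0]
    constructor
    · rintro ⟨b, hb⟩
      rw [← hb, hq]
      exact h1 _
    · intro h
      have hx : p (ι x) = 0 := (hι _).1 ⟨x, rfl⟩
      obtain ⟨u, hu⟩ := h2 (e (ι x)) (by rw [← hp, hx, map_zero]) h
      obtain ⟨b, rfl⟩ := he.2 u
      exact ⟨b, he.1 (by rw [hq, hu])⟩
  exact ⟨(QuotientAddGroup.quotientKerEquivOfSurjective π hπ).symm.trans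
    ((QuotientAddGroup.quotientAddEquivOfEq hk).trans
      (QuotientAddGroup.quotientKerEquivOfSurjective t ht))⟩

end Quotient

section Presentation

variable {k G : Type} [CommRing k] [CommGroup G] [Fintype G] (A : Rep.{0} k G) (g : G)
  (hg : ∀ x, x ∈ Subgroup.zpowers g)

include hg

/-- Odd and even degrees differ only by exchanging the norm and g − 1. Abstracting the kernel to
`K`, `ι` lets one matrix criterion, `nonempty_addEquiv_zmod`, serve both. -/
theorem exists_presentation_odd (i : ℕ) (hi : Odd i) :
    ∃ (K : Type) (_ : AddCommGroup K) (ι : K →+ A.V) (π : K →+ groupCohomology A i),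
      (∀ b, b ∈ Set.range ι ↔ A.norm.hom b = 0) ∧ Function.Surjective π ∧
      ∀ x, π x = 0 ↔ ι x ∈ Set.range (A.applyAsHom g - 𝟙 A).hom :=
  ⟨LinearMap.ker A.norm.hom.toLinearMap, inferInstance,
    (LinearMap.ker A.norm.hom.toLinearMap).subtype.toAddMonoidHom,
    (Rep.FiniteCyclicGroup.groupCohomologyπOdd A g hg i hi).hom.toAddMonoidHom,
    fun b => ⟨fun ⟨x, hx⟩ => hx ▸ x.2, fun h => ⟨⟨b, h⟩, rfl⟩⟩,
    (ModuleCat.epi_iff_surjective (Rep.FiniteCyclicGroup.groupCohomologyπOdd A g hg i hi)).1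
      (epi_comp' (@IsIso.epi_of_iso _ _ _ _ _ (Iso.isIso_inv _))
        (epi_comp' inferInstance inferInstance)),
    fun x => Rep.FiniteCyclicGroup.groupCohomologyπOdd_eq_zero_iff A g hg i hi x⟩

theorem exists_presentation_even (i : ℕ) [NeZero i] (hi : Even i) :
    ∃ (K : Type) (_ : AddCommGroup K) (ι : K →+ A.V) (π : K →+ groupCohomology A i),
      (∀ b, b ∈ Set.range ι ↔ (A.applyAsHom g - 𝟙 A).hom b = 0) ∧ Function.Surjective π ∧
      ∀ x, π x = 0 ↔ ι x ∈ Set.range A.norm.hom :=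
  ⟨LinearMap.ker (A.applyAsHom g - 𝟙 A).hom.toLinearMap, inferInstance,
    (LinearMap.ker (A.applyAsHom g - 𝟙 A).hom.toLinearMap).subtype.toAddMonoidHom,
    (Rep.FiniteCyclicGroup.groupCohomologyπEven A g hg i hi).hom.toAddMonoidHom,
    fun b => ⟨fun ⟨x, hx⟩ => hx ▸ x.2, fun h => ⟨⟨b, h⟩, rfl⟩⟩,
    (ModuleCat.epi_iff_surjective (Rep.FiniteCyclicGroup.groupCohomologyπEven A g hg i hi)).1
      (epi_comp' (@IsIso.epi_of_iso _ _ _ _ _ (Iso.isIso_inv _))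
        (epi_comp' inferInstance inferInstance)),
    fun x => Rep.FiniteCyclicGroup.groupCohomologyπEven_eq_zero_iff A g hg i hi x⟩

end Presentation

section CyclicFour

/-- A generator of the cyclic group of order four. -/
def gen4 : Multiplicative (ZMod 4) := Multiplicative.ofAdd 3

theorem mem_zpowers_gen4 (x : Multiplicative (ZMod 4)) : x ∈ Subgroup.zpowers gen4 := by
  revert x
  have h : ∀ x : Multiplicative (ZMod 4), ∃ k : Fin 4, gen4 ^ (k : ℕ) = x := by decide
  intro x
  obtain ⟨k, hk⟩ := h x
  exact ⟨(k : ℕ), by rw [← hk]; exact zpow_natCast _ _⟩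

theorem sum_cyclicFour {A : Type} [AddCommMonoid A] (f : Multiplicative (ZMod 4) → A) :
    ∑ x, f x = f 1 + f gen4 + f (gen4 ^ 2) + f (gen4 ^ 3) := by
  have h : (Finset.univ : Finset (Multiplicative (ZMod 4))) = {1, gen4, gen4 ^ 2, gen4 ^ 3} := by
    decide
  rw [h, Finset.sum_insert (by decide), Finset.sum_insert (by decide),
    Finset.sum_insert (by decide), Finset.sum_singleton, add_assoc, add_assoc]

variable (B : Rep.{0} ℤ (Multiplicative (ZMod 4))) {m : ℕ} (e : B.V →+ (Fin m → ℤ))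
  (he : Function.Bijective e) (C N : Matrix (Fin m) (Fin m) ℤ)
  (hC : ∀ b, e (B.ρ gen4 b) = C.mulVec (e b)) (hN : 1 + C + C * C + C * (C * C) = N)

theorem norm_mulVec (hC : ∀ b, e (B.ρ gen4 b) = C.mulVec (e b))
    (hN : 1 + C + C * C + C * (C * C) = N) (b : B.V) :
    e (B.norm.hom b) = N.mulVec (e b) := by
  have h : B.norm.hom b = ∑ x, B.ρ x b := by
    simp [Rep.norm, Representation.norm]
  rw [h, sum_cyclicFour, ← hN]
  simp only [map_add, map_one, Module.End.one_apply, pow_succ, pow_zero, one_mul, map_mul,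
    Module.End.mul_apply, hC, Matrix.add_mulVec, Matrix.one_mulVec, Matrix.mulVec_mulVec]

theorem sub_mulVec' (hC : ∀ b, e (B.ρ gen4 b) = C.mulVec (e b)) (b : B.V) :
    e ((B.applyAsHom gen4 - 𝟙 B).hom b) = (C - 1).mulVec (e b) := by
  have h : (B.applyAsHom gen4 - 𝟙 B).hom b = B.ρ gen4 b - b := by
    simp [Rep.sub_hom]
  rw [h, map_sub, hC, Matrix.sub_mulVec, Matrix.one_mulVec]

include he hC hN

theorem groupCohomology_odd (i : ℕ) (hi : Odd i) (d : ℕ) (r : Fin m → ℤ)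
    (h1 : ∀ u, (d : ℤ) ∣ r ⬝ᵥ (C - 1).mulVec u)
    (h2 : ∀ w, N.mulVec w = 0 → (d : ℤ) ∣ r ⬝ᵥ w → ∃ u, (C - 1).mulVec u = w)
    (w₀ : Fin m → ℤ) (hw : N.mulVec w₀ = 0) (hr : (d : ℤ) ∣ r ⬝ᵥ w₀ - 1) :
    Nonempty (groupCohomology B i ≃+ ZMod d) := by
  obtain ⟨K, _, ι, π, hι, hπ, hk⟩ := exists_presentation_odd B gen4 mem_zpowers_gen4 i hi
  exact nonempty_addEquiv_zmod e he _ _ N (C - 1) (norm_mulVec B e C N hC hN)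
    (sub_mulVec' B e C hC) ι hι π hπ hk d r h1 h2 w₀ hw hr

theorem groupCohomology_even (i : ℕ) [NeZero i] (hi : Even i) (d : ℕ) (r : Fin m → ℤ)
    (h1 : ∀ u, (d : ℤ) ∣ r ⬝ᵥ N.mulVec u)
    (h2 : ∀ w, (C - 1).mulVec w = 0 → (d : ℤ) ∣ r ⬝ᵥ w → ∃ u, N.mulVec u = w)
    (w₀ : Fin m → ℤ) (hw : (C - 1).mulVec w₀ = 0) (hr : (d : ℤ) ∣ r ⬝ᵥ w₀ - 1) :
    Nonempty (groupCohomology B i ≃+ ZMod d) := by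
  obtain ⟨K, _, ι, π, hι, hπ, hk⟩ := exists_presentation_even B gen4 mem_zpowers_gen4 i hi
  exact nonempty_addEquiv_zmod e he _ _ (C - 1) N (sub_mulVec' B e C hC)
    (norm_mulVec B e C N hC hN) ι hι π hπ hk d r h1 h2 w₀ hw hr

omit hN in
theorem groupCohomology_zero_subsingleton (h : ∀ w, (C - 1).mulVec w = 0 → w = 0) :
    Subsingleton (groupCohomology B 0) := by
  refine ⟨fun x y => ev0_injective B (he.1 ?_)⟩
  have hz : ∀ x : groupCohomology B 0, e (ev0 B x) = 0 := fun x => h _ (by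
    rw [Matrix.sub_mulVec, Matrix.one_mulVec, ← hC, ρ_ev0, sub_self])
  rw [hz, hz]

end CyclicFour

section Certificate

variable {m : ℕ}

/-- A certificate that `ker P / im Q` is cyclic of order `d`, detected by the linear form `r`. -/
theorem exists_of_certificate (P Q A B : Matrix (Fin m) (Fin m) ℤ) (d : ℕ) (r a : Fin m → ℤ)
    (c : ℤ) (hc : c ≠ 0) (hd : (d : ℤ) ≠ 0)
    (h : (c * d) • (1 : Matrix (Fin m) (Fin m) ℤ) =
      (c * d) • (Q * A) + c • Matrix.vecMulVec (Q.mulVec a) r + B * P)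
    (w : Fin m → ℤ) (hw : P.mulVec w = 0) (hr : (d : ℤ) ∣ r ⬝ᵥ w) : ∃ u, Q.mulVec u = w := by
  obtain ⟨z, hz⟩ := hr
  -- With r · w = d z, applying the certificate to `w` removes the `P` term and leaves c d w = c d
  -- Q(A w + z a). The factor `c` clears the denominators of a rational certificate.
  refine ⟨A.mulVec w + z • a, ?_⟩
  have h1 := congrArg (fun X => Matrix.mulVec X w) h
  simp only [Matrix.add_mulVec, Matrix.smul_mulVec, Matrix.one_mulVec, ← Matrix.mulVec_mulVec,
    hw, Matrix.mulVec_zero, add_zero, Matrix.vecMulVec_mulVec, hz] at h1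
  have hcd : c * d ≠ 0 := mul_ne_zero hc hd
  funext x
  have h2 := congrFun h1 x
  refine mul_left_cancel₀ hcd ?_
  simp only [Pi.add_apply, Pi.smul_apply, smul_eq_mul, Matrix.mulVec_add, Matrix.mulVec_smul,
    MulOpposite.smul_eq_mul_unop, MulOpposite.unop_op] at h2 ⊢
  linarith

theorem dvd_of_vecMul (Q : Matrix (Fin m) (Fin m) ℤ) (d : ℕ) (r s : Fin m → ℤ)
    (h : Matrix.vecMul r Q = (d : ℤ) • s) (u : Fin m → ℤ) : (d : ℤ) ∣ r ⬝ᵥ Q.mulVec u := by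
  rw [Matrix.dotProduct_mulVec, h, smul_dotProduct]
  exact Dvd.intro _ rfl

end Certificate

/-- The representation of the cyclic group of order four on row vectors given by a matrix. -/
def matrixRep {n : ℕ} (M : Matrix (Fin n) (Fin n) ℤ) (hM : M ^ 4 = 1) :
    Representation ℤ (Multiplicative (ZMod 4)) (Fin n → ℤ) where
  toFun g := (M ^ g.toAdd.val).vecMulLinear
  map_one' := by
    refine LinearMap.ext fun v => ?_
    simp
  map_mul' g h := by
    have hp : M ^ (g * h).toAdd.val = M ^ h.toAdd.val * M ^ g.toAdd.val := by
      rw [toAdd_mul, ZMod.val_add, ← pow_add, ← pow_eq_pow_mod _ hM, add_comm]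
    refine LinearMap.ext fun v => ?_
    rw [hp]
    simp [Matrix.vecMul_vecMul]

/-- The action on the kernel of the invariant linear form `l₀ + l₁ + l₂ + 2 l₃` of `matM`. -/
def mat3 : Matrix (Fin 3) (Fin 3) ℤ :=
  !![-1, 0, 1; -1, -1, 1; -2, 0, 1]

theorem mat3_pow_four : mat3 ^ 4 = 1 := by decide

/-- The lattice of rank three given by `mat3`. -/
def rho3 : Representation ℤ (Multiplicative (ZMod 4)) (Fin 3 → ℤ) := matrixRep mat3 mat3_pow_four

/-! ### The terms H^i(ℤ_4, H^j) for the two lattices -/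

section Coordinates

variable {n : ℕ} (M : Matrix (Fin n) (Fin n) ℤ) (hM : M ^ 4 = 1)

/-- The generator `gen4` is x⁻¹. Cohomology classes are pulled back along the inverse, so it acts on
them by minors of `M` rather than of its inverse. -/
theorem matrixRep_gen4_inv (i : Fin n) : matrixRep M hM gen4⁻¹ (Pi.single i 1) = M i := by
  have h : (gen4⁻¹).toAdd.val = 1 := by decide
  change Matrix.vecMul _ (M ^ (gen4⁻¹).toAdd.val) = _
  rw [h, pow_one, Matrix.single_one_vecMul]
  rfl

variable {q m : ℕ}

theorem coordMap_gen4 (hm : m = n.choose (q + 1)) (v : Fin m → Fin (q + 1) → Fin n)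
    (hv : compound 1 v = 1) (C : Matrix (Fin m) (Fin m) ℤ)
    (hC : compound M v = C)
    (x : (cohomologyRep (matrixRep M hM) (q + 1)).V) :
    coordMap v ((cohomologyRep (matrixRep M hM) (q + 1)).ρ gen4 x) = C.mulVec (coordMap v x) :=
  coordMap_cohomologyRep _ hm v hv gen4 M (matrixRep_gen4_inv M hM) C hC x

/-- The value of a class of degree zero. -/
def coordZero : groupCohomology (Rep.trivial ℤ (Multiplicative (Fin n → ℤ)) ℤ) 0 →+
    (Fin 1 → ℤ) :=
  AddMonoidHom.mk' (fun x _ => ev0 (Rep.trivial ℤ (Multiplicative (Fin n → ℤ)) ℤ) x)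
    fun x y => funext fun _ => map_add (ev0 (Rep.trivial ℤ (Multiplicative (Fin n → ℤ)) ℤ)) x y

theorem coordZero_bijective : Function.Bijective (coordZero (n := n)) := by
  constructor
  · intro x y h
    exact ev0_injective _ (congrFun h 0)
  · intro w
    obtain ⟨x, hx⟩ := exists_ev0 (Rep.trivial ℤ (Multiplicative (Fin n → ℤ)) ℤ) (w 0)
      fun _ => rfl
    refine ⟨x, funext fun i => ?_⟩
    rw [Subsingleton.elim i 0]
    exact hx

theorem coordZero_gen4 {G : Type} [Group G] (ρ : Representation ℤ G (Fin n → ℤ)) (g : G)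
    (x : (cohomologyRep ρ 0).V) :
    coordZero ((cohomologyRep ρ 0).ρ g x) = (!![1] : Matrix (Fin 1) (Fin 1) ℤ).mulVec
      (coordZero x) := by
  have h : (!![1] : Matrix (Fin 1) (Fin 1) ℤ) = 1 := by decide
  rw [h, Matrix.one_mulVec]
  funext i
  exact ev0_map (A := Rep.trivial ℤ (Multiplicative (Fin n → ℤ)) ℤ)
    (B := Rep.trivial ℤ (Multiplicative (Fin n → ℤ)) ℤ) (latticeAut ρ g⁻¹).toMonoidHom _ x

end Coordinates

/-- Index sets of minors, in lexicographic order. -/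
def idx41 : Fin 4 → Fin 1 → Fin 4 := ![![0], ![1], ![2], ![3]]

/-- Index sets of minors, in lexicographic order. -/
def idx42 : Fin 6 → Fin 2 → Fin 4 := ![![0, 1], ![0, 2], ![0, 3], ![1, 2], ![1, 3], ![2, 3]]

/-- Index sets of minors, in lexicographic order. -/
def idx43 : Fin 4 → Fin 3 → Fin 4 := ![![0, 1, 2], ![0, 1, 3], ![0, 2, 3], ![1, 2, 3]]

/-- Index sets of minors, in lexicographic order. -/
def idx44 : Fin 1 → Fin 4 → Fin 4 := ![![0, 1, 2, 3]]

/-- Index sets of minors, in lexicographic order. -/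
def idx31 : Fin 3 → Fin 1 → Fin 3 := ![![0], ![1], ![2]]

/-- Index sets of minors, in lexicographic order. -/
def idx32 : Fin 3 → Fin 2 → Fin 3 := ![![0, 1], ![0, 2], ![1, 2]]

/-- Index sets of minors, in lexicographic order. -/
def idx33 : Fin 1 → Fin 3 → Fin 3 := ![![0, 1, 2]]

/-- Here and in the computations in positive degree below, the data are, in order: the matrix of the
generator, its norm, the order d of the group, a form r with values in ℤ_d detecting it, the
quotient of r Q by d, the certificate A, B, a, c, and a cycle on which r is 1 modulo d. For a
trivial group d = 1 and r = 0. -/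
theorem E2_rhoM_4_0 :
    Nonempty (groupCohomology (cohomologyRep rhoM 0) 4 ≃+ ZMod 4) :=
  groupCohomology_even _ coordZero coordZero_bijective
    !![1]
    !![4]
    (coordZero_gen4 _ _)
    (by decide +kernel) 4 (by decide) 4 ![1]
    (dvd_of_vecMul _ _ _ ![1] (by decide +kernel))
    (exists_of_certificate _ _
      !![0]
      !![0]
      _ _ ![1] 1 (by decide) (by decide) (by decide +kernel))
    ![1] (by decide +kernel) (by decide +kernel)

theorem E2_rhoM_3_1 :
    Nonempty (groupCohomology (cohomologyRep rhoM 1) 3 ≃+ ZMod 2) :=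
  groupCohomology_odd _ (coordMap idx41)
    (coordMap_bijective (by decide) idx41 (by decide +kernel))
    !![0, 1, 0, 0; -1, 0, 0, 1; 0, 0, -1, 1; 0, 0, 0, 1]
    !![0, 0, 0, 2; 0, 0, 0, 2; 0, 0, 0, 2; 0, 0, 0, 4]
    (coordMap_gen4 matM matM_pow_four (by decide) idx41 (by decide +kernel) _ (by decide +kernel))
    (by decide +kernel) 3 (by decide) 2 ![1, -1, 1, 0]
    (dvd_of_vecMul _ _ _ ![0, 1, -1, 0] (by decide +kernel))
    (exists_of_certificate _ _
      !![-1, 0, 0, 0; 0, 0, 0, 0; 0, 0, 0, 0; -1, 1, 0, 0]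
      !![0, 0, 0, 0; 0, 0, 0, 0; 0, 0, 0, 0; 1, 0, 0, 0]
      _ _ ![0, 0, -1, 0] 1 (by decide) (by decide) (by decide +kernel))
    ![0, 0, 1, 0] (by decide +kernel) (by decide +kernel)

theorem E2_rhoM_2_2 :
    Nonempty (groupCohomology (cohomologyRep rhoM 2) 2 ≃+ ZMod 2) :=
  groupCohomology_even _ (coordMap idx42)
    (coordMap_bijective (by decide) idx42 (by decide +kernel))
    !![1, 0, 0, 0, 1, 0; 0, 0, 0, -1, 1, 0; 0, 0, 0, 0, 1, 0; 0, 1, -1, 0, 0, 1; 0, 0, -1, 0, 0, 0; 0, 0, 0, 0, 0, -1]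
    !![4, 0, -2, 0, 2, 0; 0, 0, 0, 0, 0, 0; 0, 0, 0, 0, 0, 0; 0, 0, 0, 0, 0, 0; 0, 0, 0, 0, 0, 0; 0, 0, 0, 0, 0, 0]
    (coordMap_gen4 matM matM_pow_four (by decide) idx42 (by decide +kernel) _ (by decide +kernel))
    (by decide +kernel) 2 (by decide) 2 ![1, 0, 0, 0, 0, 0]
    (dvd_of_vecMul _ _ _ ![2, 0, -1, 0, 1, 0] (by decide +kernel))
    (exists_of_certificate _ _
      !![0, 0, 0, 0, 0, 0; 0, 0, 0, 0, 0, 0; 0, 0, 0, 0, 0, 0; 0, 0, 0, 0, 0, 0; 0, 0, 0, 0, 0, 0; 0, 0, 0, 0, 0, 0]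
      !![0, 0, 0, 0, 0, 0; 4, -2, -2, 2, 0, 1; 4, 0, -4, 0, 0, 0; 0, -2, 2, -2, 0, -1; 4, 0, 0, 0, 0, 0; 0, 0, 0, 0, 0, -2]
      _ _ ![0, 0, -1, 0, 0, 0] 2 (by decide) (by decide) (by decide +kernel))
    ![1, 0, 0, 0, 0, 0] (by decide +kernel) (by decide +kernel)

theorem E2_rhoM_1_3 :
    Nonempty (groupCohomology (cohomologyRep rhoM 3) 1 ≃+ ZMod 2) :=
  groupCohomology_odd _ (coordMap idx43)
    (coordMap_bijective (by decide) idx43 (by decide +kernel))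
    !![-1, 1, 0, 1; 0, 1, 0, 0; 0, 0, 0, -1; 0, 0, 1, 0]
    !![0, 2, 0, 0; 0, 4, 0, 0; 0, 0, 0, 0; 0, 0, 0, 0]
    (coordMap_gen4 matM matM_pow_four (by decide) idx43 (by decide +kernel) _ (by decide +kernel))
    (by decide +kernel) 1 (by decide) 2 ![0, 0, 1, 1]
    (dvd_of_vecMul _ _ _ ![0, 0, 0, -1] (by decide +kernel))
    (exists_of_certificate _ _
      !![0, 0, 0, 0; 1, 0, 0, 0; 0, 0, -1, 0; 0, 0, 0, 0]
      !![0, 0, 0, 0; 1, 0, 0, 0; 0, 0, 0, 0; 0, 0, 0, 0]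
      _ _ ![0, 1, 1, -1] 1 (by decide) (by decide) (by decide +kernel))
    ![0, 0, 0, 1] (by decide +kernel) (by decide +kernel)

theorem E2_rho3_3_0 :
    Nonempty (groupCohomology (cohomologyRep rho3 0) 3 ≃+ ZMod 1) :=
  groupCohomology_odd _ coordZero coordZero_bijective
    !![1]
    !![4]
    (coordZero_gen4 _ _)
    (by decide +kernel) 3 (by decide) 1 ![0]
    (dvd_of_vecMul _ _ _ ![0] (by decide +kernel))
    (exists_of_certificate _ _
      !![0]
      !![1]
      _ _ ![0] 4 (by decide) (by decide) (by decide +kernel))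
    ![0] (by decide +kernel) (by decide +kernel)

theorem E2_rho3_2_1 :
    Nonempty (groupCohomology (cohomologyRep rho3 1) 2 ≃+ ZMod 1) :=
  groupCohomology_even _ (coordMap idx31)
    (coordMap_bijective (by decide) idx31 (by decide +kernel))
    !![-1, 0, 1; -1, -1, 1; -2, 0, 1]
    !![0, 0, 0; 0, 0, 0; 0, 0, 0]
    (coordMap_gen4 mat3 mat3_pow_four (by decide) idx31 (by decide +kernel) _ (by decide +kernel))
    (by decide +kernel) 2 (by decide) 1 ![0, 0, 0]
    (dvd_of_vecMul _ _ _ ![0, 0, 0] (by decide +kernel))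
    (exists_of_certificate _ _
      !![0, 0, 0; 0, 0, 0; 0, 0, 0]
      !![0, 0, -2; 2, -2, -1; 4, 0, -4]
      _ _ ![0, 0, 0] 4 (by decide) (by decide) (by decide +kernel))
    ![0, 0, 0] (by decide +kernel) (by decide +kernel)

theorem E2_rho3_1_2 :
    Nonempty (groupCohomology (cohomologyRep rho3 2) 1 ≃+ ZMod 1) :=
  groupCohomology_odd _ (coordMap idx32)
    (coordMap_bijective (by decide) idx32 (by decide +kernel))
    !![1, 0, 1; 0, 1, 0; -2, 1, -1]
    !![0, 2, 0; 0, 4, 0; 0, 0, 0]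
    (coordMap_gen4 mat3 mat3_pow_four (by decide) idx32 (by decide +kernel) _ (by decide +kernel))
    (by decide +kernel) 1 (by decide) 1 ![0, 0, 0]
    (dvd_of_vecMul _ _ _ ![0, 0, 0] (by decide +kernel))
    (exists_of_certificate _ _
      !![0, 0, 0; 2, 0, 1; 1, 0, 0]
      !![0, 0, 0; 1, 0, 0; 0, 0, 0]
      _ _ ![0, 0, 0] 2 (by decide) (by decide) (by decide +kernel))
    ![0, 0, 0] (by decide +kernel) (by decide +kernel)

theorem E2_rho3_4_0 :
    Nonempty (groupCohomology (cohomologyRep rho3 0) 4 ≃+ ZMod 4) :=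
  groupCohomology_even _ coordZero coordZero_bijective
    !![1]
    !![4]
    (coordZero_gen4 _ _)
    (by decide +kernel) 4 (by decide) 4 ![1]
    (dvd_of_vecMul _ _ _ ![1] (by decide +kernel))
    (exists_of_certificate _ _
      !![0]
      !![0]
      _ _ ![1] 1 (by decide) (by decide) (by decide +kernel))
    ![1] (by decide +kernel) (by decide +kernel)

theorem E2_rho3_3_1 :
    Nonempty (groupCohomology (cohomologyRep rho3 1) 3 ≃+ ZMod 4) :=
  groupCohomology_odd _ (coordMap idx31)
    (coordMap_bijective (by decide) idx31 (by decide +kernel))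
    !![-1, 0, 1; -1, -1, 1; -2, 0, 1]
    !![0, 0, 0; 0, 0, 0; 0, 0, 0]
    (coordMap_gen4 mat3 mat3_pow_four (by decide) idx31 (by decide +kernel) _ (by decide +kernel))
    (by decide +kernel) 3 (by decide) 4 ![-2, 2, 1]
    (dvd_of_vecMul _ _ _ ![0, -1, 0] (by decide +kernel))
    (exists_of_certificate _ _
      !![-1, 1, 0; 0, 0, 0; -1, 2, 0]
      !![0, 0, 0; 0, 0, 0; 0, 0, 0]
      _ _ ![-2, -1, -4] 1 (by decide) (by decide) (by decide +kernel))
    ![0, 0, 1] (by decide +kernel) (by decide +kernel)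

theorem E2_rho3_2_2 :
    Nonempty (groupCohomology (cohomologyRep rho3 2) 2 ≃+ ZMod 2) :=
  groupCohomology_even _ (coordMap idx32)
    (coordMap_bijective (by decide) idx32 (by decide +kernel))
    !![1, 0, 1; 0, 1, 0; -2, 1, -1]
    !![0, 2, 0; 0, 4, 0; 0, 0, 0]
    (coordMap_gen4 mat3 mat3_pow_four (by decide) idx32 (by decide +kernel) _ (by decide +kernel))
    (by decide +kernel) 2 (by decide) 2 ![1, 0, 0]
    (dvd_of_vecMul _ _ _ ![0, 1, 0] (by decide +kernel))
    (exists_of_certificate _ _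
      !![0, 0, 0; 0, 0, 0; 0, 0, 0]
      !![0, 0, 0; 4, 0, 2; 2, 0, 0]
      _ _ ![0, 1, 0] 1 (by decide) (by decide) (by decide +kernel))
    ![1, 2, 0] (by decide +kernel) (by decide +kernel)

theorem E2_rho3_1_3 :
    Nonempty (groupCohomology (cohomologyRep rho3 3) 1 ≃+ ZMod 2) :=
  groupCohomology_odd _ (coordMap idx33)
    (coordMap_bijective (by decide) idx33 (by decide +kernel))
    !![-1]
    !![0]
    (coordMap_gen4 mat3 mat3_pow_four (by decide) idx33 (by decide +kernel) _ (by decide +kernel))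
    (by decide +kernel) 1 (by decide) 2 ![1]
    (dvd_of_vecMul _ _ _ ![-1] (by decide +kernel))
    (exists_of_certificate _ _
      !![0]
      !![0]
      _ _ ![-1] 1 (by decide) (by decide) (by decide +kernel))
    ![1] (by decide +kernel) (by decide +kernel)

/-- The top exterior power is acted on by det M = −1 and has no nonzero invariants. -/
theorem E2_rhoM_0_4 : Subsingleton (groupCohomology (cohomologyRep rhoM 4) 0) :=
  groupCohomology_zero_subsingleton _ (coordMap idx44)
    (coordMap_bijective (by decide) idx44 (by decide +kernel)) !![-1]
    (coordMap_gen4 matM matM_pow_four (by decide) idx44 (by decide +kernel) _ (by decide +kernel))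
    (fun w h => by
      have h0 := congrFun h 0
      simp [Matrix.mulVec, dotProduct] at h0
      funext i
      rw [Subsingleton.elim i 0]
      simpa using h0)

theorem E2_rho3_0_3 : Subsingleton (groupCohomology (cohomologyRep rho3 3) 0) :=
  groupCohomology_zero_subsingleton _ (coordMap idx33)
    (coordMap_bijective (by decide) idx33 (by decide +kernel)) !![-1]
    (coordMap_gen4 mat3 mat3_pow_four (by decide) idx33 (by decide +kernel) _ (by decide +kernel))
    (fun w h => by
      have h0 := congrFun h 0
      simp [Matrix.mulVec, dotProduct] at h0
      funext i
      rw [Subsingleton.elim i 0]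
      simpa using h0)

/-! ### Assembling the direct sum -/

section DirectSumFive

/-- A pair of sum `n` as an index. -/
def sumIndex {n : ℕ} (i j : ℕ) (h : i + j = n) : Finset.HasAntidiagonal.antidiagonal n :=
  ⟨(i, j), Finset.HasAntidiagonal.mem_antidiagonal.2 h⟩

variable (β : ℕ × ℕ → Type) [∀ p, AddCommGroup (β p)]

/-- A component of an element of a direct sum over pairs of sum `n`. -/
def component {n : ℕ} (i j : ℕ) (h : i + j = n) :
    (⨁ p : Finset.HasAntidiagonal.antidiagonal n, β p.1) →+ β (i, j) :=
  DFinsupp.evalAddMonoidHom (β := fun p : Finset.HasAntidiagonal.antidiagonal n => β p.1)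
    (sumIndex i j h)

/-- The inclusion of a summand of a direct sum over pairs of sum `n`. -/
def summand {n : ℕ} (i j : ℕ) (h : i + j = n) :
    β (i, j) →+ (⨁ p : Finset.HasAntidiagonal.antidiagonal n, β p.1) :=
  DirectSum.of (fun p : Finset.HasAntidiagonal.antidiagonal n => β p.1) (sumIndex i j h)

variable {n : ℕ}

theorem component_summand_same (i j : ℕ) (h : i + j = n) (x : β (i, j)) :
    component β i j h (summand β i j h x) = x :=
  DirectSum.of_eq_same (β := fun p : Finset.HasAntidiagonal.antidiagonal n => β p.1)
    (sumIndex i j h) x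

theorem component_summand_of_ne (i j i' j' : ℕ) (h : i + j = n) (h' : i' + j' = n) (hi : i ≠ i')
    (x : β (i, j)) : component β i' j' h' (summand β i j h x) = 0 :=
  DirectSum.of_eq_of_ne (β := fun p : Finset.HasAntidiagonal.antidiagonal n => β p.1)
    (sumIndex i j h) (sumIndex i' j' h') x
    fun he => hi (congrArg (fun p : Finset.HasAntidiagonal.antidiagonal n => p.1.1) he).symm

/-- The components of an element of a direct sum over pairs of sum four. -/
def antidiagonalFour (hβ : Subsingleton (β (0, 4))) :
    (⨁ p : Finset.HasAntidiagonal.antidiagonal 4, β p.1) ≃+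
      β (4, 0) × β (3, 1) × β (2, 2) × β (1, 3) :=
  AddEquiv.ofBijective ((component β 4 0 rfl).prod ((component β 3 1 rfl).prod
    ((component β 2 2 rfl).prod (component β 1 3 rfl)))) <| by
    constructor
    · intro x y h
      refine DFinsupp.ext ?_
      simp only [AddMonoidHom.prod_apply, Prod.mk.injEq] at h
      rintro ⟨⟨i, j⟩, hp⟩
      have hij : i + j = 4 := Finset.HasAntidiagonal.mem_antidiagonal.1 hp
      obtain rfl : j = 4 - i := by omega
      have hi : i ≤ 4 := by omega
      interval_cases i
      · exact Subsingleton.elim (α := β (0, 4)) _ _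
      · exact h.2.2.2
      · exact h.2.2.1
      · exact h.2.1
      · exact h.1
    · rintro ⟨a, b, c, d⟩
      refine ⟨summand β 4 0 rfl a + summand β 3 1 rfl b + summand β 2 2 rfl c +
        summand β 1 3 rfl d, ?_⟩
      simp [component_summand_same, component_summand_of_ne]

end DirectSumFive

theorem E2Sum_rhoM : Nonempty (E2Sum rhoM 4 ≃+ (ZMod 4 × ZMod 2 × ZMod 2 × ZMod 2)) := by
  obtain ⟨e0⟩ := E2_rhoM_4_0
  obtain ⟨e1⟩ := E2_rhoM_3_1
  obtain ⟨e2⟩ := E2_rhoM_2_2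
  obtain ⟨e3⟩ := E2_rhoM_1_3
  exact ⟨(antidiagonalFour (fun p => groupCohomology (cohomologyRep rhoM p.2) p.1)
    E2_rhoM_0_4).trans (e0.prodCongr (e1.prodCongr (e2.prodCongr e3)))⟩

theorem not_nonempty_zmod_addEquiv :
    ¬ Nonempty ((ZMod 4 × ZMod 4) ≃+ (ZMod 4 × ZMod 2 × ZMod 2 × ZMod 2)) := by
  rintro ⟨e⟩
  have h := Nat.card_congr e.toEquiv
  simp at h

/-! ### Bounds for the cohomology of ℤ^3 ⋊ ℤ_4 -/

section SemidirectProduct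

variable {G L : Type} [Group G] [AddCommGroup L] (ρ : Representation ℤ G L)

/-- The split extension `L → L ⋊ G → G`. -/
def semidirectSplit : SplitExt (Multiplicative L) (Gam ρ) G where
  i := SemidirectProduct.inl
  s := SemidirectProduct.inr
  p := SemidirectProduct.rightHom
  i_injective := SemidirectProduct.inl_injective
  p_s _ := rfl
  p_i _ := rfl
  exists_i x hx := ⟨x.left, SemidirectProduct.ext rfl hx.symm⟩

theorem semidirectSplit_conj (g : G) :
    (semidirectSplit ρ).conj ((semidirectSplit ρ).s g) = (latticeAut ρ g⁻¹).toMonoidHom := by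
  refine MonoidHom.ext fun n => (semidirectSplit ρ).i_injective ?_
  rw [SplitExt.i_conj]
  change (SemidirectProduct.inr g)⁻¹ * SemidirectProduct.inl n * SemidirectProduct.inr g =
    SemidirectProduct.inl (latticeAut ρ g⁻¹ n)
  rw [SemidirectProduct.inl_aut, inv_inv, map_inv]

theorem hs_semidirectSplit (j : ℕ) :
    (semidirectSplit ρ).hs (Rep.trivial ℤ (Gam ρ) ℤ) j = cohomologyRep ρ j := by
  have h : ((semidirectSplit ρ).hs (Rep.trivial ℤ (Gam ρ) ℤ) j).ρ = (cohomologyRep ρ j).ρ :=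
    MonoidHom.ext fun g => congrArg ModuleCat.Hom.hom
      (groupCohomology.map_congr (semidirectSplit_conj ρ g) (by ext; rfl) j)
  exact congrArg Rep.of h

end SemidirectProduct

section Sizes

theorem cardBound_of_equiv {A : Type} [AddCommGroup A] {d m : ℕ} [NeZero d]
    (h : Nonempty (A ≃+ ZMod d)) (hd : d ≤ 2 ^ m) : cardBound.le m A := by
  obtain ⟨e⟩ := h
  refine ⟨Finite.of_equiv _ e.symm.toEquiv, ?_⟩
  rw [Nat.card_congr e.toEquiv, Nat.card_zmod]
  exact hd

theorem subsingleton_of_cardBound {A : Type} [AddCommGroup A] (h : cardBound.le 0 A) :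
    Subsingleton A := by
  obtain ⟨_, h⟩ := h
  exact Finite.card_le_one_iff_subsingleton.1 h

/-- `H^k(ℤ^3 ⋊ ℤ_4, ℤ)` for the lattice `rho3`. -/
theorem subsingleton_H3_rho3 : Subsingleton (HGam rho3 3) := by
  refine subsingleton_of_cardBound ?_
  refine (semidirectSplit rho3).le_groupCohomology cardBound 3 _ (fun _ => 0) fun i j h => ?_
  rw [hs_semidirectSplit]
  obtain rfl : j = 3 - i := by omega
  have hi : i ≤ 3 := by omega
  interval_cases i
  · exact cardBound.le_zero _ E2_rho3_0_3
  · exact cardBound_of_equiv E2_rho3_1_2 (by decide)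
  · exact cardBound_of_equiv E2_rho3_2_1 (by decide)
  · exact cardBound_of_equiv E2_rho3_3_0 (by decide)

/-- The terms for j = 0, 1, 2, 3 have orders 4, 4, 2, 2, and the one for j = 4 vanishes; the
exponents of 2 add up to 6. -/
theorem card_H4_rho3 : cardBound.le 6 (HGam rho3 4) := by
  refine (semidirectSplit rho3).le_groupCohomology cardBound 4 _
    (fun j => if j < 2 then 2 else if j < 4 then 1 else 0) fun i j h => ?_
  rw [hs_semidirectSplit]
  obtain rfl : j = 4 - i := by omega
  have hi : i ≤ 4 := by omega
  interval_cases i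
  · refine cardBound.le_zero _ ?_
    -- The binomial coefficient of 4 in 3 is zero, so H^4(ℤ^3) has no generators.
    obtain ⟨f, hf⟩ : genBound.le 0 _ := gen_lattice 3 4
    have h4 : Subsingleton (groupCohomology
      (Rep.trivial ℤ (Multiplicative (Fin 3 → ℤ)) ℤ) 4) := hf.subsingleton
    exact ⟨fun x y => ev0_injective _ (h4.elim _ _)⟩
  · exact cardBound_of_equiv E2_rho3_1_3 (by decide)
  · exact cardBound_of_equiv E2_rho3_2_2 (by decide)
  · exact cardBound_of_equiv E2_rho3_3_1 (by decide)
  · exact cardBound_of_equiv E2_rho3_4_0 (by decide)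

end Sizes

/-! ### Reduction to the kernel of the invariant form -/

section Sublattice

/-- A basis of the kernel of `l₀ + l₁ + l₂ + 2 l₃`. -/
def kernelMatrix : Matrix (Fin 3) (Fin 4) ℤ :=
  !![-1, 1, 0, 0; -1, 0, 1, 0; -2, 0, 0, 1]

theorem mat3_mul_kernelMatrix (k : ZMod 4) :
    kernelMatrix * matM ^ k.val = mat3 ^ k.val * kernelMatrix := by
  revert k
  decide +kernel

theorem matM_mulVec (k : ZMod 4) : (matM ^ k.val).mulVec ![1, 1, 1, 2] = ![1, 1, 1, 2] := by
  revert k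
  decide +kernel

/-- The inclusion `ℤ^3 ⋊ ℤ_4 → ℤ^4 ⋊ ℤ_4`. -/
def kernelIncl : Gam rho3 →* Gam rhoM :=
  SemidirectProduct.map (AddMonoidHom.toMultiplicative kernelMatrix.vecMulLinear.toAddMonoidHom)
    (MonoidHom.id _) fun g => MonoidHom.ext fun l => by
      change Matrix.vecMul (Matrix.vecMul l.toAdd (mat3 ^ g.toAdd.val)) kernelMatrix =
        Matrix.vecMul (Matrix.vecMul l.toAdd kernelMatrix) (matM ^ g.toAdd.val)
      rw [Matrix.vecMul_vecMul, Matrix.vecMul_vecMul, mat3_mul_kernelMatrix]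

/-- The invariant linear form `l₀ + l₁ + l₂ + 2 l₃`. -/
def invariantForm : Gam rhoM →* Multiplicative ℤ :=
  SemidirectProduct.lift
    (AddMonoidHom.toMultiplicative (AddMonoidHom.mk' (fun l : Fin 4 → ℤ => l ⬝ᵥ ![1, 1, 1, 2])
      fun l l' => add_dotProduct l l' _)) 1 fun g => MonoidHom.ext fun l => by
      rw [MonoidHom.one_apply, map_one]
      change Matrix.vecMul l.toAdd (matM ^ g.toAdd.val) ⬝ᵥ ![1, 1, 1, 2] = l.toAdd ⬝ᵥ ![1, 1, 1, 2]
      rw [← Matrix.dotProduct_mulVec, matM_mulVec]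

/-- `ℤ^4 ⋊ ℤ_4` is an extension of `ℤ` by `ℤ^3 ⋊ ℤ_4`. -/
def kernelSplit : SplitExt (Gam rho3) (Gam rhoM) (Multiplicative ℤ) where
  i := kernelIncl
  s := SemidirectProduct.inl.comp
    (AddMonoidHom.toMultiplicative (AddMonoidHom.single (fun _ : Fin 4 => ℤ) 0))
  p := invariantForm
  i_injective x y h := by
    have h1 : Matrix.vecMul x.left.toAdd kernelMatrix = Matrix.vecMul y.left.toAdd kernelMatrix :=
      congrArg (fun z => z.left.toAdd) h
    refine SemidirectProduct.ext ?_ (congrArg (fun z => z.right) h)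
    have h2 := congrFun h1 1
    have h3 := congrFun h1 2
    have h4 := congrFun h1 3
    simp only [Matrix.vecMul, dotProduct, kernelMatrix, Fin.sum_univ_three] at h2 h3 h4
    refine congrArg Multiplicative.ofAdd (?_ : x.left.toAdd = y.left.toAdd)
    funext i
    fin_cases i
    · simpa using h2
    · simpa using h3
    · simpa using h4
  p_s t := by
    change ((Pi.single 0 t.toAdd : Fin 4 → ℤ) ⬝ᵥ ![1, 1, 1, 2]) + (0 : ℤ) = t.toAdd
    simp
  p_i x := by
    change (Matrix.vecMul x.left.toAdd kernelMatrix ⬝ᵥ ![1, 1, 1, 2]) + (0 : ℤ) = 0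
    rw [← Matrix.dotProduct_mulVec]
    have h : kernelMatrix.mulVec ![1, 1, 1, 2] = 0 := by decide
    rw [h, dotProduct_zero, add_zero]
  exists_i x hx := by
    have h : (x.left.toAdd ⬝ᵥ ![1, 1, 1, 2]) + (0 : ℤ) = 0 := hx
    refine ⟨⟨Multiplicative.ofAdd ![x.left.toAdd 1, x.left.toAdd 2, x.left.toAdd 3], x.right⟩, ?_⟩
    refine SemidirectProduct.ext (?_ : Matrix.vecMul ![x.left.toAdd 1, x.left.toAdd 2,
      x.left.toAdd 3] kernelMatrix = x.left.toAdd) rfl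
    simp only [dotProduct, Fin.sum_univ_four] at h
    simp at h
    funext i
    fin_cases i <;> simp [Matrix.vecMul, dotProduct, kernelMatrix, Fin.sum_univ_three]
    linarith

/-- The kernel is bounded by H^1(ℤ, H^3(Γ₃)), zero because H^3(Γ₃) is, and by cohomology of ℤ in
degrees at least two. -/
theorem resMap_kernelSplit_injective :
    Function.Injective (kernelSplit.resMap (Rep.trivial ℤ (Gam rhoM) ℤ) 4) := by
  rw [← LinearMap.ker_eq_bot]
  have h := kernelSplit.le_ker_resMap cardBound 4 (Rep.trivial ℤ (Gam rhoM) ℤ) (fun _ => 0)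
    fun i j h => by
      rcases i with _ | i
      · obtain rfl : j = 3 := by omega
        exact le_infiniteCyclic_one _ cardBound (cardBound.le_zero _ subsingleton_H3_rho3)
      · exact cardBound.le_zero _ (subsingleton_infiniteCyclic _ i)
  have := subsingleton_of_cardBound (by simpa using h)
  exact Submodule.subsingleton_iff_eq_bot.1 this

end Sublattice

/-! ### Evaluating degree-four classes on elements of order four -/

section Detection

variable {Γ Γ' : Type} [Group Γ] [Group Γ']

theorem d_three_apply (f : (Fin 3 → Γ) → ℤ) (a b c e : Γ) :
    inhomogeneousCochains.d (Rep.trivial ℤ Γ ℤ) 3 f ![a, b, c, e] =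
      f ![b, c, e] - f ![a * b, c, e] + f ![a, b * c, e] - f ![a, b, c * e] + f ![a, b, c] := by
  have h : ∀ j : Fin 4, Fin.contractNth j (· * ·) ![a, b, c, e] =
      ![![a * b, c, e], ![a, b * c, e], ![a, b, c * e], ![a, b, c]] j := by
    intro j
    funext i
    fin_cases j <;> fin_cases i <;> rfl
  have h1 : inhomogeneousCochains.d (Rep.trivial ℤ Γ ℤ) 3 f ![a, b, c, e] = f ![b, c, e] +
      ∑ j : Fin 4, (-1 : ℤ) ^ ((j : ℕ) + 1) * f (Fin.contractNth j (· * ·) ![a, b, c, e]) :=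
    inhomogeneousCochains.d_hom_apply _ _ _ _
  refine h1.trans ?_
  rw [Fin.sum_univ_four, h, h, h, h]
  change f ![b, c, e] + ((-1) ^ 1 * f ![a * b, c, e] + (-1) ^ 2 * f ![a, b * c, e] +
    (-1) ^ 3 * f ![a, b, c * e] + (-1) ^ 4 * f ![a, b, c]) = _
  ring

theorem d_four_apply (f : (Fin 4 → Γ) → ℤ) (g : Fin 5 → Γ) :
    inhomogeneousCochains.d (Rep.trivial ℤ Γ ℤ) 4 f g =
      f ![g 1, g 2, g 3, g 4] - f ![g 0 * g 1, g 2, g 3, g 4] + f ![g 0, g 1 * g 2, g 3, g 4] -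
        f ![g 0, g 1, g 2 * g 3, g 4] + f ![g 0, g 1, g 2, g 3 * g 4] -
          f ![g 0, g 1, g 2, g 3] := by
  have h : ∀ j : Fin 5, Fin.contractNth j (· * ·) g =
      ![![g 0 * g 1, g 2, g 3, g 4], ![g 0, g 1 * g 2, g 3, g 4], ![g 0, g 1, g 2 * g 3, g 4],
        ![g 0, g 1, g 2, g 3 * g 4], ![g 0, g 1, g 2, g 3]] j := by
    intro j
    funext i
    fin_cases j <;> fin_cases i <;> rfl
  have h0 : (fun i : Fin 4 => g i.succ) = ![g 1, g 2, g 3, g 4] := by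
    funext i
    fin_cases i <;> rfl
  have h1 : inhomogeneousCochains.d (Rep.trivial ℤ Γ ℤ) 4 f g = f (fun i : Fin 4 => g i.succ) +
      ∑ j : Fin 5, (-1 : ℤ) ^ ((j : ℕ) + 1) * f (Fin.contractNth j (· * ·) g) :=
    inhomogeneousCochains.d_hom_apply _ _ _ _
  refine h1.trans ?_
  rw [Fin.sum_univ_five, h, h, h, h, h, h0]
  change f ![g 1, g 2, g 3, g 4] + ((-1) ^ 1 * f ![g 0 * g 1, g 2, g 3, g 4] +
    (-1) ^ 2 * f ![g 0, g 1 * g 2, g 3, g 4] + (-1) ^ 3 * f ![g 0, g 1, g 2 * g 3, g 4] +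
    (-1) ^ 4 * f ![g 0, g 1, g 2, g 3 * g 4] + (-1) ^ 5 * f ![g 0, g 1, g 2, g 3]) = _
  ring

/-- The sum of the values of a 4-cochain on the cycle of an element of order four. -/
def cycleSum (y : Γ) : ((Fin 4 → Γ) → ℤ) →ₗ[ℤ] ZMod 4 :=
  (Int.castAddHom (ZMod 4)).toIntLinearMap ∘ₗ
    ∑ i ∈ Finset.range 4, ∑ j ∈ Finset.range 4, LinearMap.proj ![y ^ i, y, y ^ j, y]

theorem cycleSum_apply (y : Γ) (f : (Fin 4 → Γ) → ℤ) :
    cycleSum y f = ((∑ i ∈ Finset.range 4, ∑ j ∈ Finset.range 4, f ![y ^ i, y, y ^ j, y] : ℤ) :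
      ZMod 4) := by
  simp [cycleSum]

theorem sum_pow_succ {M : Type} [AddCommMonoid M] {y : Γ} (hy : y ^ 4 = 1) (f : Γ → M) :
    ∑ i ∈ Finset.range 4, f (y ^ i * y) = ∑ i ∈ Finset.range 4, f (y ^ i) := by
  simp only [← pow_succ]
  rw [Finset.sum_range_succ, Finset.sum_range_succ' (fun i => f (y ^ i)), hy, pow_zero]

/-- The chain Σ [y^i | y | y^j | y] is a cycle modulo 4. After shifting i or j by one, four of the
five faces cancel in pairs; the remaining face does not depend on i and so occurs four times. -/
theorem cycleSum_d {y : Γ} (hy : y ^ 4 = 1) (f : (Fin 3 → Γ) → ℤ) :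
    cycleSum y (inhomogeneousCochains.d (Rep.trivial ℤ Γ ℤ) 3 f) = 0 := by
  have hc : ∀ j, y * y ^ j = y ^ j * y := fun j => ((Commute.refl y).pow_right j).eq
  refine (cycleSum_apply _ _).trans ((congrArg _ (Finset.sum_congr rfl fun i _ =>
    Finset.sum_congr rfl fun j _ => d_three_apply f (y ^ i) y (y ^ j) y)).trans ?_)
  simp only [Finset.sum_add_distrib, Finset.sum_sub_distrib, hc]
  have h1 : ∀ i, ∑ j ∈ Finset.range 4, f ![y ^ i, y ^ j * y, y] =
      ∑ j ∈ Finset.range 4, f ![y ^ i, y ^ j, y] := fun i =>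
    sum_pow_succ hy fun z => f ![y ^ i, z, y]
  have h2 : ∀ i, ∑ j ∈ Finset.range 4, f ![y ^ i, y, y ^ j * y] =
      ∑ j ∈ Finset.range 4, f ![y ^ i, y, y ^ j] := fun i =>
    sum_pow_succ hy fun z => f ![y ^ i, y, z]
  have h3 : ∑ i ∈ Finset.range 4, ∑ j ∈ Finset.range 4, f ![y ^ i * y, y ^ j, y] =
      ∑ i ∈ Finset.range 4, ∑ j ∈ Finset.range 4, f ![y ^ i, y ^ j, y] :=
    sum_pow_succ hy fun z => ∑ j ∈ Finset.range 4, f ![z, y ^ j, y]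
  simp only [h1, h2, h3]
  rw [Finset.sum_const, Finset.card_range]
  push_cast
  have h4 : (4 : ZMod 4) = 0 := by decide
  simp [h4]

/-- Evaluation of classes of degree four on the cycle of an element of order four. -/
def detect (y : Γ) (hy : y ^ 4 = 1) :
    groupCohomology (Rep.trivial ℤ Γ ℤ) 4 →ₗ[ℤ] ZMod 4 :=
  descend (A := Rep.trivial ℤ Γ ℤ) (cycleSum y) (cycleSum_d hy)

theorem detect_cls (y : Γ) (hy : y ^ 4 = 1) (f : (Fin 4 → Γ) → ℤ) (hf) :
    detect y hy (cls (A := Rep.trivial ℤ Γ ℤ) f hf) = cycleSum y f :=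
  descend_cls (A := Rep.trivial ℤ Γ ℤ) (cycleSum y) (cycleSum_d hy) f hf

theorem detect_map (φ : Γ →* Γ') (F : Rep.res φ (Rep.trivial ℤ Γ' ℤ) ⟶ Rep.trivial ℤ Γ ℤ)
    (hF : ∀ z, F.hom z = z) (y : Γ) (hy : y ^ 4 = 1) (hy' : φ y ^ 4 = 1)
    (x : groupCohomology (Rep.trivial ℤ Γ' ℤ) 4) :
    detect y hy (groupCohomology.map φ F 4 x) = detect (φ y) hy' x := by
  obtain ⟨f, hf, rfl⟩ := exists_cls x
  rw [map_cls φ F f hf (map_cocycle φ F f hf)]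
  refine (detect_cls y hy _ _).trans (Eq.trans ?_ (detect_cls (φ y) hy' f hf).symm)
  rw [cycleSum_apply, cycleSum_apply]
  refine congrArg _ (Finset.sum_congr rfl fun i _ => Finset.sum_congr rfl fun j _ => ?_)
  refine (hF _).trans (congrArg f ?_)
  funext k
  fin_cases k
  · exact map_pow φ y i
  · rfl
  · exact map_pow φ y j
  · rfl

theorem detect_conj (c y y' : Γ) (hy : y ^ 4 = 1) (hy' : y' ^ 4 = 1) (h : c * y' = y * c)
    (x : groupCohomology (Rep.trivial ℤ Γ ℤ) 4) : detect y' hy' x = detect y hy x := by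
  have hf : ∀ g, MonoidHom.id Γ ((MulAut.conj c⁻¹).toMonoidHom g) = c⁻¹ * g * c := fun g => by simp
  have h1 := conjMap_self 4 c (MulAut.conj c⁻¹).toMonoidHom hf (Rep.trivial ℤ Γ ℤ) x
  have h2 : (MulAut.conj c⁻¹).toMonoidHom y = y' := by
    refine (hf y).trans ?_
    rw [mul_assoc, ← h, inv_mul_cancel_left]
  subst h2
  refine Eq.trans ?_ (congrArg (detect y hy) h1)
  exact (detect_map (MulAut.conj c⁻¹).toMonoidHom
    (conjHom (MonoidHom.id Γ) c (MulAut.conj c⁻¹).toMonoidHom hf (Rep.trivial ℤ Γ ℤ))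
    (fun _ => rfl) y hy hy' x).symm

/-- Integral 2-cocycles with trivial coefficients. -/
def IsCocycleTwo (c : Γ → Γ → ℤ) : Prop :=
  ∀ g h k, c h k + c g (h * k) = c (g * h) k + c g h

theorem IsCocycleTwo.comp {c : Γ' → Γ' → ℤ} (hc : IsCocycleTwo c) (φ : Γ →* Γ') :
    IsCocycleTwo fun g h => c (φ g) (φ h) := fun g h k => by
  simp only [map_mul]
  exact hc _ _ _

/-- The cup product of two 2-cochains. -/
def cup (c c' : Γ → Γ → ℤ) (g : Fin 4 → Γ) : ℤ := c (g 0) (g 1) * c' (g 2) (g 3)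

theorem d_cup {c c' : Γ → Γ → ℤ} (hc : IsCocycleTwo c) (hc' : IsCocycleTwo c') :
    inhomogeneousCochains.d (Rep.trivial ℤ Γ ℤ) 4 (cup c c') = 0 := by
  funext g
  rw [d_four_apply]
  change c (g 1) (g 2) * c' (g 3) (g 4) - c (g 0 * g 1) (g 2) * c' (g 3) (g 4) +
    c (g 0) (g 1 * g 2) * c' (g 3) (g 4) - c (g 0) (g 1) * c' (g 2 * g 3) (g 4) +
    c (g 0) (g 1) * c' (g 2) (g 3 * g 4) - c (g 0) (g 1) * c' (g 2) (g 3) = (0 : ℤ)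
  linear_combination c' (g 3) (g 4) * hc (g 0) (g 1) (g 2) +
    c (g 0) (g 1) * hc' (g 2) (g 3) (g 4)

/-- The cup product of two classes of degree two. -/
def cupClass {c c' : Γ → Γ → ℤ} (hc : IsCocycleTwo c) (hc' : IsCocycleTwo c') :
    groupCohomology (Rep.trivial ℤ Γ ℤ) 4 :=
  cls (A := Rep.trivial ℤ Γ ℤ) (cup c c') (d_cup hc hc')

/-- The value of a 2-cochain on the cycle of an element of order four. -/
def cycleTwo (c : Γ → Γ → ℤ) (y : Γ) : ℤ := ∑ i ∈ Finset.range 4, c (y ^ i) y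

/-- The cycle is a product of two copies of Σ [y^i | y], so the double sum factors and products of
2-classes are evaluated one factor at a time. -/
theorem detect_cupClass {c c' : Γ → Γ → ℤ} (hc : IsCocycleTwo c) (hc' : IsCocycleTwo c') (y : Γ)
    (hy : y ^ 4 = 1) : detect y hy (cupClass hc hc') = (cycleTwo c y * cycleTwo c' y : ℤ) := by
  refine (detect_cls y hy _ _).trans ?_
  rw [cycleSum_apply, cycleTwo, cycleTwo, Finset.sum_mul_sum]
  rfl

/-- The Bockstein cocycle of a character of order four. -/
def bockstein (χ : Γ →* Multiplicative (ZMod 4)) (g h : Γ) : ℤ :=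
  if (χ g).toAdd.val + (χ h).toAdd.val < 4 then 0 else 1

theorem four_mul_bockstein (χ : Γ →* Multiplicative (ZMod 4)) (g h : Γ) :
    4 * bockstein χ g h = (χ g).toAdd.val + (χ h).toAdd.val - (χ (g * h)).toAdd.val := by
  have key : ∀ a b : ZMod 4, 4 * (if a.val + b.val < 4 then 0 else 1 : ℤ) =
    a.val + b.val - (a + b).val := by decide
  rw [map_mul]
  exact key _ _

theorem isCocycleTwo_bockstein (χ : Γ →* Multiplicative (ZMod 4)) :
    IsCocycleTwo (bockstein χ) := fun g h k => by
  have h1 := four_mul_bockstein χ h k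
  have h2 := four_mul_bockstein χ g (h * k)
  have h3 := four_mul_bockstein χ (g * h) k
  have h4 := four_mul_bockstein χ g h
  rw [← mul_assoc] at h2
  linarith

/-- Four times the Bockstein is the coboundary of the lift of χ to {0, 1, 2, 3}; summed over the
powers of `y`, all but four copies of the lift of χ(y) cancel. -/
theorem cycleTwo_bockstein (χ : Γ →* Multiplicative (ZMod 4)) {y : Γ} (hy : y ^ 4 = 1) :
    cycleTwo (bockstein χ) y = (χ y).toAdd.val := by
  have h1 : 4 * cycleTwo (bockstein χ) y = 4 * (χ y).toAdd.val := by
    rw [cycleTwo, Finset.mul_sum]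
    simp only [four_mul_bockstein]
    rw [Finset.sum_sub_distrib, Finset.sum_add_distrib,
      sum_pow_succ hy fun z => ((χ z).toAdd.val : ℤ)]
    simp
  linarith

end Detection

/-! ### An invariant area class -/

section Cocycles

/-- The parity of the exponent of an element of the cyclic group of order four. -/
def parity (g : Multiplicative (ZMod 4)) : ℤ := (g.toAdd.val % 2 : ℕ)

theorem parity_mul (g h : Multiplicative (ZMod 4)) :
    parity (g * h) = parity g + parity h - 2 * (parity g * parity h) := by
  revert g h
  decide +kernel

/-- The action of `rhoM` on the first two coordinates. -/
theorem rhoM_apply_zero (g : Multiplicative (ZMod 4)) (l : Fin 4 → ℤ) :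
    rhoM g l 0 = (matM ^ g.toAdd.val) 0 0 * l 0 - (matM ^ g.toAdd.val) 0 1 * l 1 ∧
    rhoM g l 1 = (matM ^ g.toAdd.val) 0 1 * l 0 + (matM ^ g.toAdd.val) 0 0 * l 1 := by
  have h : ∀ k : ZMod 4, (matM ^ k.val) 1 0 = -(matM ^ k.val) 0 1 ∧
      (matM ^ k.val) 1 1 = (matM ^ k.val) 0 0 ∧ (matM ^ k.val) 2 0 = 0 ∧
      (matM ^ k.val) 2 1 = 0 ∧ (matM ^ k.val) 3 0 = 0 ∧ (matM ^ k.val) 3 1 = 0 := by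
    decide +kernel
  obtain ⟨h1, h2, h3, h4, h5, h6⟩ := h g.toAdd
  constructor
  · change Matrix.vecMul l (matM ^ g.toAdd.val) 0 = _
    rw [Matrix.vecMul, dotProduct, Fin.sum_univ_four, h1, h3, h5]
    ring
  · change Matrix.vecMul l (matM ^ g.toAdd.val) 1 = _
    rw [Matrix.vecMul, dotProduct, Fin.sum_univ_four, h2, h4, h6]
    ring

/-- The entries of the rotation by which the group acts on the first two coordinates. -/
theorem rotation_cases (g : Multiplicative (ZMod 4)) :
    ((matM ^ g.toAdd.val) 0 1 = 0 ∧ parity g = 0 ∧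
      ((matM ^ g.toAdd.val) 0 0 = 1 ∨ (matM ^ g.toAdd.val) 0 0 = -1)) ∨
    ((matM ^ g.toAdd.val) 0 0 = 0 ∧ parity g = 1 ∧
      ((matM ^ g.toAdd.val) 0 1 = 1 ∨ (matM ^ g.toAdd.val) 0 1 = -1)) := by
  revert g
  decide +kernel

/-- The cocycle extending the cup product of the first two coordinates. -/
def areaCochain (x y : Gam rhoM) : ℤ :=
  x.left.toAdd 0 * rhoM x.right y.left.toAdd 1 -
    parity x.right * (y.left.toAdd 0 * y.left.toAdd 1)

/-- The group rotates the first two coordinates by quarter turns. An odd turn carries l₀ ⊗ l₁ to −l₁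
⊗ l₀, which differs from l₀ ⊗ l₁ by the coboundary of l₀ l₁ up to sign; the parity term of the
cochain compensates for this. -/
theorem isCocycleTwo_areaCochain : IsCocycleTwo areaCochain := fun x y z => by
  have hl : ∀ u v : Gam rhoM, (u * v).left.toAdd = u.left.toAdd + rhoM u.right v.left.toAdd :=
    fun _ _ => rfl
  have hm : rhoM (x.right * y.right) z.left.toAdd = rhoM x.right (rhoM y.right z.left.toAdd) :=
    congr($(map_mul rhoM x.right y.right) _)
  simp only [areaCochain, hl, SemidirectProduct.mul_right, map_add, Pi.add_apply, hm, parity_mul]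
  have h1 := rhoM_apply_zero x.right (rhoM y.right z.left.toAdd)
  have h2 := rhoM_apply_zero x.right y.left.toAdd
  have h3 := rhoM_apply_zero y.right z.left.toAdd
  rw [h1.2, h2.1, h2.2, h3.1, h3.2]
  rcases rotation_cases x.right with ⟨r1, r2, r3 | r3⟩ | ⟨r1, r2, r3 | r3⟩ <;>
    rcases rotation_cases y.right with ⟨s1, s2, s3 | s3⟩ | ⟨s1, s2, s3 | s3⟩ <;>
    rw [r1, r2, r3, s1, s2, s3] <;> ring

end Cocycles

/-! ### Torsion elements, detection and the final count -/

section Elements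

/-- Elements of `ℤ^4 ⋊ ℤ_4` over the generator. -/
def liftM (l : Fin 4 → ℤ) : Gam rhoM := ⟨Multiplicative.ofAdd l, Multiplicative.ofAdd 1⟩

/-- Elements of `ℤ^3 ⋊ ℤ_4` over the generator. -/
def lift3 (l : Fin 3 → ℤ) : Gam rho3 := ⟨Multiplicative.ofAdd l, Multiplicative.ofAdd 1⟩

theorem liftM_pow_four (l : Fin 4 → ℤ) (h : ((liftM l) ^ 4).left.toAdd = 0) : liftM l ^ 4 = 1 :=
  SemidirectProduct.ext h ((map_pow SemidirectProduct.rightHom (liftM l) 4).trans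
    (show Multiplicative.ofAdd (1 : ZMod 4) ^ 4 = 1 by decide))

theorem lift3_pow_four (l : Fin 3 → ℤ) (h : ((lift3 l) ^ 4).left.toAdd = 0) : lift3 l ^ 4 = 1 :=
  SemidirectProduct.ext h ((map_pow SemidirectProduct.rightHom (lift3 l) 4).trans
    (show Multiplicative.ofAdd (1 : ZMod 4) ^ 4 = 1 by decide))

/-- Four elements of order four in `ℤ^3 ⋊ ℤ_4`. -/
def torsion3 : Fin 4 → Gam rho3 :=
  ![lift3 ![0, 0, 0], lift3 ![-1, 0, 0], lift3 ![0, 1, -1], lift3 ![0, -1, 0]]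

theorem torsion3_pow_four (k : Fin 4) : torsion3 k ^ 4 = 1 := by
  fin_cases k <;> exact lift3_pow_four _ (by decide +kernel)

/-- Two elements of order four in `ℤ^4 ⋊ ℤ_4`. -/
def torsionM : Fin 2 → Gam rhoM := ![liftM ![0, 0, 0, 0], liftM ![1, 0, 1, -1]]

theorem torsionM_pow_four (k : Fin 2) : torsionM k ^ 4 = 1 := by
  fin_cases k <;> exact liftM_pow_four _ (by decide +kernel)

/-- The character `2 u₀ + u₁`. -/
def charThree : Gam rho3 →* Multiplicative (ZMod 4) :=
  SemidirectProduct.lift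
    (AddMonoidHom.toMultiplicative ((Int.castAddHom (ZMod 4)).comp
      (AddMonoidHom.mk' (fun l : Fin 3 → ℤ => l ⬝ᵥ ![2, 1, 0]) fun l l' => add_dotProduct l l' _)))
    1 fun g => MonoidHom.ext fun l => by
      rw [MonoidHom.one_apply, map_one]
      change ((Matrix.vecMul l.toAdd (mat3 ^ g.toAdd.val) ⬝ᵥ ![2, 1, 0] : ℤ) : ZMod 4) =
        ((l.toAdd ⬝ᵥ ![2, 1, 0] : ℤ) : ZMod 4)
      rw [← Matrix.dotProduct_mulVec, ← sub_eq_zero, ← Int.cast_sub, ← dotProduct_sub]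
      -- The form is invariant only modulo 4. The quotient by 4 has entries in {−1, 0, 1}, encoded
      -- in `Fin 3` to keep the search finite.
      have h : ∀ k : ZMod 4, ∃ a : Fin 3 → Fin 3, (mat3 ^ k.val).mulVec ![2, 1, 0] - ![2, 1, 0] =
        (4 : ℤ) • fun i => ((a i : ℕ) : ℤ) - 1 := by decide +kernel
      obtain ⟨a, ha⟩ := h g.toAdd
      rw [ha, dotProduct_smul, smul_eq_mul, Int.cast_mul]
      have h4 : ((4 : ℤ) : ZMod 4) = 0 := by decide
      rw [h4, zero_mul]

/-- The character given by the quotient of order four. -/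
def charZero {n : ℕ} (ρ : Representation ℤ (Multiplicative (ZMod 4)) (Fin n → ℤ)) :
    Gam ρ →* Multiplicative (ZMod 4) := SemidirectProduct.rightHom

theorem cycleTwo_areaCochain_M (k : Fin 2) : cycleTwo areaCochain (torsionM k) = ![0, 1] k := by
  revert k
  decide +kernel

theorem cycleTwo_areaCochain_3 (k : Fin 4) :
    (cycleTwo (fun g h => areaCochain (kernelIncl g) (kernelIncl h)) (torsion3 k) : ZMod 4) =
      ![0, 0, 1, 1] k := by
  revert k
  decide +kernel

/-- The values are distinct, so the four elements are pairwise non-conjugate in Γ₃. They represent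
all of L₃/(x − 1)L₃, which has order four. -/
theorem charThree_torsion3 (k : Fin 4) :
    (charThree (torsion3 k)).toAdd = ![0, 2, 1, 3] k := by
  revert k
  decide +kernel

/-- The four detecting functionals of `ℤ^3 ⋊ ℤ_4`. -/
def detect3 : HGam rho3 4 →+ (Fin 4 → ZMod 4) :=
  AddMonoidHom.mk' (fun x k => detect (torsion3 k) (torsion3_pow_four k) x) fun x y =>
    funext fun k => map_add (detect (torsion3 k) (torsion3_pow_four k)) x y

/-- The two detecting functionals of `ℤ^4 ⋊ ℤ_4`. -/
def detectM : HGam rhoM 4 →+ ZMod 4 × ZMod 4 :=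
  AddMonoidHom.mk' (fun x => (detect (torsionM 0) (torsionM_pow_four 0) x,
      detect (torsionM 1) (torsionM_pow_four 1) x)) fun x y =>
    Prod.ext (map_add (detect (torsionM 0) (torsionM_pow_four 0)) x y)
      (map_add (detect (torsionM 1) (torsionM_pow_four 1)) x y)

theorem exists_detect3 (a c : ZMod 4) (b d : Fin 2) :
    ∃ x, detect3 x = ![a, a + 2 * (b : ℕ), a + c, a + c + 2 * (d : ℕ)] := by
  let hχ := isCocycleTwo_bockstein (charZero rho3)
  let hψ := isCocycleTwo_bockstein charThree
  let hl := isCocycleTwo_areaCochain.comp kernelIncl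
  have z1 : ∀ k, cycleTwo (bockstein (charZero rho3)) (torsion3 k) = 1 := fun k => by
    rw [cycleTwo_bockstein _ (torsion3_pow_four k)]
    revert k
    decide +kernel
  have z2 : ∀ k, ((cycleTwo (bockstein charThree) (torsion3 k) : ℤ) : ZMod 4) =
      ![0, 2, 1, 3] k := fun k => by
    rw [cycleTwo_bockstein _ (torsion3_pow_four k), charThree_torsion3]
    revert k
    decide +kernel
  have z3 := cycleTwo_areaCochain_3
  have e1 : detect3 (cupClass hχ hχ) = ![1, 1, 1, 1] := by
    funext k
    refine (detect_cupClass hχ hχ _ (torsion3_pow_four k)).trans ?_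
    rw [z1]
    revert k
    decide
  have e2 : detect3 (cupClass hχ hψ) = ![0, 2, 1, 3] := by
    funext k
    refine (detect_cupClass hχ hψ _ (torsion3_pow_four k)).trans ?_
    rw [z1, one_mul, z2]
  have e3 : detect3 (cupClass hl hl) = ![0, 0, 1, 1] := by
    funext k
    refine (detect_cupClass hl hl _ (torsion3_pow_four k)).trans ?_
    rw [Int.cast_mul, z3]
    revert k
    decide
  have e4 : detect3 (cupClass hl hψ) = ![0, 0, 1, 3] := by
    funext k
    refine (detect_cupClass hl hψ _ (torsion3_pow_four k)).trans ?_
    rw [Int.cast_mul, z3, z2]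
    revert k
    decide
  -- The two differences evaluate to (0, 2, 0, 0) and (0, 0, 0, 2), while the two squares give (1,
  -- 1, 1, 1) and (0, 0, 1, 1).
  refine ⟨a.val • cupClass hχ hχ + (b : ℕ) • (cupClass hχ hψ - cupClass hl hψ) +
    c.val • cupClass hl hl + (d : ℕ) • (cupClass hl hl - cupClass hl hψ), ?_⟩
  simp only [map_add, map_nsmul, map_sub, e1, e2, e3, e4]
  revert a b c d
  decide +kernel

/-- The parameters (a, b, c, d) give 4 · 2 · 4 · 2 = 64 distinct values, and the group has at most
64 elements, so each class is one of those constructed and is determined by its value. -/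
theorem detect3_injective : Function.Injective detect3 := by
  obtain ⟨_, hcard⟩ := card_H4_rho3
  choose f hf using fun t : (ZMod 4 × Fin 2) × ZMod 4 × Fin 2 =>
    exists_detect3 t.1.1 t.2.1 t.1.2 t.2.2
  have hinj : Function.Injective fun t : (ZMod 4 × Fin 2) × ZMod 4 × Fin 2 =>
      (![t.1.1, t.1.1 + 2 * (t.1.2 : ℕ), t.1.1 + t.2.1, t.1.1 + t.2.1 + 2 * (t.2.2 : ℕ)] :
        Fin 4 → ZMod 4) := by
    rintro ⟨⟨a, b⟩, c, d⟩ ⟨⟨a', b'⟩, c', d'⟩ h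
    have key : ∀ b b' : Fin 2, (2 * (b : ℕ) : ZMod 4) = 2 * (b' : ℕ) → b = b' := by decide
    have h0 : a = a' := congrFun h 0
    subst h0
    have h2 : a + c = a + c' := congrFun h 2
    obtain rfl := add_left_cancel h2
    have h1 : a + 2 * (b : ℕ) = a + 2 * (b' : ℕ) := congrFun h 1
    have h3 : a + c + 2 * (d : ℕ) = a + c + 2 * (d' : ℕ) := congrFun h 3
    rw [key _ _ (add_left_cancel h1), key _ _ (add_left_cancel h3)]
  have hfi : Function.Injective (detect3 ∘ f) := by
    rwa [show detect3 ∘ f = _ from funext hf]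
  have hbij : Function.Bijective f :=
    hfi.of_comp.bijective_of_nat_card_le (hcard.trans (by simp))
  intro x y hxy
  obtain ⟨s, rfl⟩ := hbij.2 x
  obtain ⟨t, rfl⟩ := hbij.2 y
  rw [hfi hxy]

theorem detect_resMap (k : Fin 4) (y : Gam rhoM) (hy : y ^ 4 = 1)
    (h : kernelIncl (torsion3 k) = y) (x : HGam rhoM 4) :
    detect (torsion3 k) (torsion3_pow_four k)
      (kernelSplit.resMap (Rep.trivial ℤ (Gam rhoM) ℤ) 4 x) = detect y hy x := by
  subst h
  exact detect_map kernelIncl (𝟙 _) (fun _ => rfl) _ _ _ x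

/-- Restriction to Γ₃ is injective and its values are read off at four elements. In Γ these become
conjugate in pairs, through translations outside L₃, so two evaluations suffice. -/
theorem detectM_injective : Function.Injective detectM := by
  intro x y hxy
  have h0 : detect (torsionM 0) (torsionM_pow_four 0) x =
    detect (torsionM 0) (torsionM_pow_four 0) y := congrArg Prod.fst hxy
  have h1 : detect (torsionM 1) (torsionM_pow_four 1) x =
    detect (torsionM 1) (torsionM_pow_four 1) y := congrArg Prod.snd hxy
  refine resMap_kernelSplit_injective (detect3_injective (funext fun k => ?_))
  have hk : kernelIncl (torsion3 k) ^ 4 = 1 := by rw [← map_pow, torsion3_pow_four, map_one]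
  refine (detect_resMap k _ hk rfl x).trans (Eq.trans ?_ (detect_resMap k _ hk rfl y).symm)
  obtain ⟨j, c, hc⟩ : ∃ (j : Fin 2) (c : Gam rhoM),
      c * kernelIncl (torsion3 k) = torsionM j * c := by
    -- Translation by `v` carries the lift with vector `l` to the one with vector l' exactly when l'
    -- − l = v − v M.
    have hm : ∀ (v l l' : Fin 4 → ℤ), v + l = l' + Matrix.vecMul v matM →
        (⟨Multiplicative.ofAdd v, 1⟩ : Gam rhoM) * liftM l =
          liftM l' * ⟨Multiplicative.ofAdd v, 1⟩ := by
      intro v l l' h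
      refine SemidirectProduct.ext (?_ : v + Matrix.vecMul l (matM ^ 0) =
        l' + Matrix.vecMul v (matM ^ 1)) rfl
      rw [pow_zero, Matrix.vecMul_one, pow_one, h]
    fin_cases k
    · exact ⟨0, _, hm 0 _ _ (by decide +kernel)⟩
    · exact ⟨0, _, hm ![-1, 0, 0, 0] _ _ (by decide +kernel)⟩
    · exact ⟨1, _, hm 0 _ _ (by decide +kernel)⟩
    · exact ⟨1, _, hm ![0, 0, 1, -1] _ _ (by decide +kernel)⟩
  rw [detect_conj c _ _ (torsionM_pow_four j) hk hc x,
    detect_conj c _ _ (torsionM_pow_four j) hk hc y]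
  fin_cases j
  · exact h0
  · exact h1

/-- The squares of the Bockstein class and of the area class evaluate to (1, 1) and (0, 1), which
generate ℤ_4 ⊕ ℤ_4. -/
theorem detectM_surjective : Function.Surjective detectM := by
  let hχ := isCocycleTwo_bockstein (charZero rhoM)
  let hl := isCocycleTwo_areaCochain
  have z1 : ∀ k, cycleTwo (bockstein (charZero rhoM)) (torsionM k) = 1 := fun k => by
    rw [cycleTwo_bockstein _ (torsionM_pow_four k)]
    revert k
    decide +kernel
  have e1 : detectM (cupClass hχ hχ) = (1, 1) := by
    refine Prod.ext ((detect_cupClass hχ hχ _ (torsionM_pow_four 0)).trans ?_)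
      ((detect_cupClass hχ hχ _ (torsionM_pow_four 1)).trans ?_)
    · rw [z1]
      decide
    · rw [z1]
      decide
  have e2 : detectM (cupClass hl hl) = (0, 1) := by
    refine Prod.ext ((detect_cupClass hl hl _ (torsionM_pow_four 0)).trans ?_)
      ((detect_cupClass hl hl _ (torsionM_pow_four 1)).trans ?_)
    · rw [cycleTwo_areaCochain_M]
      decide
    · rw [cycleTwo_areaCochain_M]
      decide
  rintro ⟨a, b⟩
  refine ⟨a.val • cupClass hχ hχ + (b - a).val • cupClass hl hl, ?_⟩
  simp only [map_add, map_nsmul, e1, e2]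
  revert a b
  decide +kernel

theorem HGam_rhoM : Nonempty (HGam rhoM 4 ≃+ (ZMod 4 × ZMod 4)) :=
  ⟨AddEquiv.ofBijective detectM ⟨detectM_injective, detectM_surjective⟩⟩

theorem not_nonempty_HGam_addEquiv_E2Sum : ¬ Nonempty (HGam rhoM 4 ≃+ E2Sum rhoM 4) := by
  rintro ⟨e⟩
  obtain ⟨f⟩ := HGam_rhoM
  obtain ⟨g⟩ := E2Sum_rhoM
  exact not_nonempty_zmod_addEquiv ⟨f.symm.trans (e.trans g)⟩

end Elements

end SplitLattice

end

theorem mainTheorem1 :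
    Nonempty (SplitLattice.HGam rhoM 4 ≃+ (ZMod 4 × ZMod 4)) ∧
    Nonempty (SplitLattice.E2Sum rhoM 4 ≃+ (ZMod 4 × ZMod 2 × ZMod 2 × ZMod 2)) ∧
    ¬ Nonempty (SplitLattice.HGam rhoM 4 ≃+ SplitLattice.E2Sum rhoM 4) ∧
    ¬ AdemGePanPetrosyanConjecture := by
  refine ⟨SplitLattice.HGam_rhoM, SplitLattice.E2Sum_rhoM,
    SplitLattice.not_nonempty_HGam_addEquiv_E2Sum, fun h => ?_⟩
  exact SplitLattice.not_nonempty_HGam_addEquiv_E2Sum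
    (h (Multiplicative (ZMod 4)) (Fin 4 → ℤ) rhoM 4)
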